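/- Let $R$ be a commutative artinian ring. An artin $R$-algebra is an $R$-algebra $\Lambda$ that is finitely generated as an $R$-module; all $\Lambda$-modules are finitely generated, and $\operatorname{add} T$ denotes the class of direct summands of finite direct sums of copies of $T$. A $\Lambda$-module $T$ is self-orthogonal if $\operatorname{Ext}^i_\Lambda(T,T)=0$ for all $i>0$. Write ${}^\perp T$ (resp. $T^\perp$) for the class of modules $X$ with $\operatorname{Ext}^i_\Lambda(X,T)=0$ (resp. $\operatorname{Ext}^i_\Lambda(T,X)=0$) for all $i>0$. For $T$ self-orthogonal, let $\mathcal X_T$ be the class of modules $X$ having an exact sequence $0\to X\xrightarrow{f^0} T^0\xrightarrow{f^1} T^1\xrightarrow{f^2}\cdots$ with $T^i\in\operatorname{add}T$ and $\operatorname{Im} f^i\in{}^\perp T$ for all $i\ge 0$, and let $\mathcal Y_T$ be the class of modules $Y$ having an exact sequence $\cdots\xrightarrow{g_2} T_1\xrightarrow{g_1} T_0\xrightarrow{g_0} Y\to 0$ with $T_i\in\operatorname{add}T$ and $\operatorname{Im} g_i\in T^\perp$ for all $i\ge 0$. The module $T$ is Wakamatsu tilting if it is self-orthogonal and $\Lambda\in\mathcal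 X_T$. It is tilting if it has finite projective dimension, is self-orthogonal, and there is an exact sequence $0\to\Lambda\to T^0\to\cdots\to T^d\to 0$ with all $T^i\in\operatorname{add}T$. Consider the following three statements. (WTC) For every artin $R$-algebra $\Lambda$, every Wakamatsu tilting $\Lambda$-module of finite projective dimension is tilting. (GS) Let $\mathcal E$ be a Krull–Schmidt $R$-linear Quillen exact category whose Hom-modules are finitely generated over $R$, with a progenerator $P$ (that is, $\mathcal E$ has enough projectives and the projective objects are exactly those of $\operatorname{add}P$) and an injective cogenerator $I$ (that is, $\mathcal E$ has enough injectives and the injective objects are exactly those of $\operatorname{add}I$). If $I$ has finite projective dimension in $\mathcal E$, then $P$ has finite injective dimension in $\mathcal E$. (UP) For every artin $R$-algebra $\Lambda$ and all Wakamatsu tilting $\Lambda$-modules $T$ and $U$ with $T\in\mathcal X_U$ and $U\in\mathcal Y_T$: if $U$ is tilting, then $T$ is tilting. Then (WTC) holds if and only if (GS) holds, and (WTC) implies (UP). -/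

import Mathlib

open CategoryTheory CategoryTheory.Limits

universe u w v

namespace WTilt

/-! ## Additive closure, Krull–Schmidt and Hom-finite categories -/

section Additive

variable {C : Type w} [Category.{v} C] [Preadditive C] [HasFiniteBiproducts C]

/-- `InAdd T X`: the object `X` belongs to `add T`, that is, it is a direct summand of a finite
direct sum of copies of `T`. -/
def InAdd (T X : C) : Prop :=
  ∃ n : ℕ, Nonempty (Retract X (⨁ fun _ : Fin n => T))

variable (C) in
/-- Every object is a finite direct sum of objects with local endomorphism rings. -/
def IsKrullSchmidt : Prop :=
  ∀ X : C, ∃ (n : ℕ) (Y : Fin n → C),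
    (∀ i, IsLocalRing (End (Y i))) ∧ Nonempty (X ≅ ⨁ Y)

end Additive

/-- All Hom modules of an `R`-linear category are finitely generated over `R`
(equivalently of finite length, when `R` is artinian). -/
def IsHomFinite (R : Type u) [CommRing R] (C : Type w) [Category.{v} C] [Preadditive C]
    [Linear R C] : Prop :=
  ∀ X Y : C, Module.Finite R (X ⟶ Y)

/-! ## Quillen exact categories -/

/-- An exact structure (in the sense of Quillen) on an additive category: an isomorphism-closed
class of kernel-cokernel pairs, called conflations. A morphism is an inflation (a deflation) if it
is the first (second) morphism of a conflation. -/
structure ExactStructure (C : Type w) [Category.{v} C] [Preadditive C]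
    [HasFiniteBiproducts C] where
  /-- the class of conflations `X₁ ⟶ X₂ ⟶ X₃` -/
  conflation : ShortComplex C → Prop
  of_iso : ∀ {S S' : ShortComplex C}, (S ≅ S') → conflation S → conflation S'
  isKernel : ∀ {S : ShortComplex C}, conflation S →
    Nonempty (IsLimit (KernelFork.ofι S.f S.zero))
  isCokernel : ∀ {S : ShortComplex C}, conflation S →
    Nonempty (IsColimit (CokernelCofork.ofπ S.g S.zero))
  inflation_id : ∀ X : C, ∃ (Z : C) (g : X ⟶ Z) (h : 𝟙 X ≫ g = 0),
    conflation (ShortComplex.mk (𝟙 X) g h)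
  deflation_id : ∀ Z : C, ∃ (X : C) (f : X ⟶ Z) (h : f ≫ 𝟙 Z = 0),
    conflation (ShortComplex.mk f (𝟙 Z) h)
  inflation_comp : ∀ {X Y Z : C} (i : X ⟶ Y) (j : Y ⟶ Z),
    (∃ (W : C) (g : Y ⟶ W) (h : i ≫ g = 0), conflation (ShortComplex.mk i g h)) →
    (∃ (W : C) (g : Z ⟶ W) (h : j ≫ g = 0), conflation (ShortComplex.mk j g h)) →
    ∃ (W : C) (g : Z ⟶ W) (h : (i ≫ j) ≫ g = 0), conflation (ShortComplex.mk (i ≫ j) g h)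
  deflation_comp : ∀ {X Y Z : C} (p : X ⟶ Y) (q : Y ⟶ Z),
    (∃ (W : C) (f : W ⟶ X) (h : f ≫ p = 0), conflation (ShortComplex.mk f p h)) →
    (∃ (W : C) (f : W ⟶ Y) (h : f ≫ q = 0), conflation (ShortComplex.mk f q h)) →
    ∃ (W : C) (f : W ⟶ X) (h : f ≫ (p ≫ q) = 0), conflation (ShortComplex.mk f (p ≫ q) h)
  /-- the pushout of an inflation along any morphism exists and is an inflation -/
  inflation_pushout : ∀ {X Y X' : C} (i : X ⟶ Y) (a : X ⟶ X'),
    (∃ (W : C) (g : Y ⟶ W) (h : i ≫ g = 0), conflation (ShortComplex.mk i g h)) →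
    ∃ (Y' : C) (b : Y ⟶ Y') (i' : X' ⟶ Y'), IsPushout i a b i' ∧
      ∃ (W : C) (g : Y' ⟶ W) (h : i' ≫ g = 0), conflation (ShortComplex.mk i' g h)
  /-- the pullback of a deflation along any morphism exists and is a deflation -/
  deflation_pullback : ∀ {Y Z Z' : C} (p : Y ⟶ Z) (c : Z' ⟶ Z),
    (∃ (W : C) (f : W ⟶ Y) (h : f ≫ p = 0), conflation (ShortComplex.mk f p h)) →
    ∃ (Y' : C) (b : Y' ⟶ Y) (p' : Y' ⟶ Z'), IsPullback b p' p c ∧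
      ∃ (W : C) (f : W ⟶ Y') (h : f ≫ p' = 0), conflation (ShortComplex.mk f p' h)

namespace ExactStructure

variable {C : Type w} [Category.{v} C] [Preadditive C] [HasFiniteBiproducts C]
  (𝓔 : ExactStructure C)

/-- `Q` is projective: it has the lifting property with respect to all deflations
(equivalently, `Ext¹(Q, -) = 0`: all conflations ending in `Q` split). -/
def IsProjective (Q : C) : Prop :=
  ∀ S : ShortComplex C, 𝓔.conflation S → ∀ a : Q ⟶ S.X₃, ∃ b : Q ⟶ S.X₂, b ≫ S.g = a

/-- `J` is injective: it has the extension property with respect to all inflations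
(equivalently, `Ext¹(-, J) = 0`: all conflations starting in `J` split). -/
def IsInjective (J : C) : Prop :=
  ∀ S : ShortComplex C, 𝓔.conflation S → ∀ a : S.X₁ ⟶ J, ∃ b : S.X₂ ⟶ J, S.f ≫ b = a

/-- `P` is a progenerator: there are enough projectives, and the projectives are exactly the
objects of `add P`. -/
def IsProgenerator (P : C) : Prop :=
  (∀ X : C, ∃ (K Q : C) (f : K ⟶ Q) (g : Q ⟶ X) (h : f ≫ g = 0),
    𝓔.conflation (ShortComplex.mk f g h) ∧ 𝓔.IsProjective Q) ∧
  ∀ X : C, InAdd P X ↔ 𝓔.IsProjective X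

/-- `I` is an injective cogenerator: there are enough injectives, and the injectives are exactly
the objects of `add I`. -/
def IsInjectiveCogenerator (I : C) : Prop :=
  (∀ X : C, ∃ (J K : C) (f : X ⟶ J) (g : J ⟶ K) (h : f ≫ g = 0),
    𝓔.conflation (ShortComplex.mk f g h) ∧ 𝓔.IsInjective J) ∧
  ∀ X : C, InAdd I X ↔ 𝓔.IsInjective X

/-- `X` has a projective resolution `0 → Qₙ → ⋯ → Q₀ → X → 0` of length `n`, spliced from
conflations. -/
def ProjDimLE : ℕ → C → Prop
  | 0, X => 𝓔.IsProjective X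
  | n + 1, X => ∃ (K Q : C) (f : K ⟶ Q) (g : Q ⟶ X) (h : f ≫ g = 0),
      𝓔.conflation (ShortComplex.mk f g h) ∧ 𝓔.IsProjective Q ∧ ProjDimLE n K

/-- `X` has an injective resolution `0 → X → J⁰ → ⋯ → Jⁿ → 0` of length `n`, spliced from
conflations. -/
def InjDimLE : ℕ → C → Prop
  | 0, X => 𝓔.IsInjective X
  | n + 1, X => ∃ (J K : C) (f : X ⟶ J) (g : J ⟶ K) (h : f ≫ g = 0),
      𝓔.conflation (ShortComplex.mk f g h) ∧ 𝓔.IsInjective J ∧ InjDimLE n K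

/-- `X` has finite projective dimension in the exact category. -/
def FiniteProjDim (X : C) : Prop := ∃ n : ℕ, 𝓔.ProjDimLE n X

/-- `X` has finite injective dimension in the exact category. -/
def FiniteInjDim (X : C) : Prop := ∃ n : ℕ, 𝓔.InjDimLE n X

end ExactStructure

/-! ## Wakamatsu tilting theory for finitely generated modules -/

section Modules

variable {Λ : Type u} [Ring Λ]

/-- An exact sequence `0 → X → C⁰ → C¹ → C² → ⋯` of `Λ`-modules. -/
structure Coresolution (X : ModuleCat.{u} Λ) where
  obj : ℕ → ModuleCat.{u} Λ
  ι : X ⟶ obj 0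
  d : ∀ i, obj i ⟶ obj (i + 1)
  injective : Function.Injective ι.hom
  exact_zero : Function.Exact ι.hom (d 0).hom
  exact_succ : ∀ i, Function.Exact (d i).hom (d (i + 1)).hom

/-- An exact sequence `⋯ → C₂ → C₁ → C₀ → Y → 0` of `Λ`-modules. -/
structure Resolution (Y : ModuleCat.{u} Λ) where
  obj : ℕ → ModuleCat.{u} Λ
  π : obj 0 ⟶ Y
  d : ∀ i, obj (i + 1) ⟶ obj i
  surjective : Function.Surjective π.hom
  exact_zero : Function.Exact (d 0).hom π.hom
  exact_succ : ∀ i, Function.Exact (d (i + 1)).hom (d i).hom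

/-- The class `{}^⊥ T` of finitely generated modules `X` with `Ext^{>0}(X, T) = 0`. -/
def LeftPerp (T X : ModuleCat.{u} Λ) : Prop :=
  Module.Finite Λ X ∧ ∀ i : ℕ, 0 < i → Subsingleton (Abelian.Ext X T i)

/-- The class `T^⊥` of finitely generated modules `Y` with `Ext^{>0}(T, Y) = 0`. -/
def RightPerp (T Y : ModuleCat.{u} Λ) : Prop :=
  Module.Finite Λ Y ∧ ∀ i : ℕ, 0 < i → Subsingleton (Abelian.Ext T Y i)

/-- `T` is finitely generated and `Ext^{>0}(T, T) = 0`. -/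
def IsSelfOrthogonal (T : ModuleCat.{u} Λ) : Prop :=
  Module.Finite Λ T ∧ ∀ i : ℕ, 0 < i → Subsingleton (Abelian.Ext T T i)

/-- The class `𝒳_T`: finitely generated modules `X` having an exact sequence
`0 → X → T⁰ → T¹ → ⋯` with all `Tⁱ` in `add T` and all images of its maps in `{}^⊥ T`
(the image of `X → T⁰` is isomorphic to `X`). -/
def ClassX (T X : ModuleCat.{u} Λ) : Prop :=
  LeftPerp T X ∧ ∃ c : Coresolution X, (∀ i, InAdd T (c.obj i)) ∧
    ∀ i, LeftPerp T (ModuleCat.of Λ (LinearMap.range (c.d i).hom))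

/-- The class `𝒴_T`: finitely generated modules `Y` having an exact sequence
`⋯ → T₁ → T₀ → Y → 0` with all `Tᵢ` in `add T` and all images of its maps in `T^⊥`
(the image of `T₀ → Y` is `Y`). -/
def ClassY (T Y : ModuleCat.{u} Λ) : Prop :=
  RightPerp T Y ∧ ∃ c : Resolution Y, (∀ i, InAdd T (c.obj i)) ∧
    ∀ i, RightPerp T (ModuleCat.of Λ (LinearMap.range (c.d i).hom))

/-- `T` is Wakamatsu tilting: it is self-orthogonal and `Λ ∈ 𝒳_T`. -/
def IsWakamatsuTilting (T : ModuleCat.{u} Λ) : Prop :=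
  IsSelfOrthogonal T ∧ ClassX T (ModuleCat.of Λ Λ)

/-- `T` has finite projective dimension. -/
def FinitePD (T : ModuleCat.{u} Λ) : Prop := ∃ n : ℕ, HasProjectiveDimensionLE T n

/-- `T` is tilting: it has finite projective dimension, is self-orthogonal, and there is an exact
sequence `0 → Λ → T⁰ → ⋯ → Tᵈ → 0` with all `Tⁱ` in `add T`. -/
def IsTilting (T : ModuleCat.{u} Λ) : Prop :=
  FinitePD T ∧ IsSelfOrthogonal T ∧
    ∃ (d : ℕ) (c : Coresolution (ModuleCat.of Λ Λ)),
      (∀ i, i ≤ d → InAdd T (c.obj i)) ∧ ∀ i, d < i → IsZero (c.obj i)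

end Modules

/-! ## The three conjectures over a base ring

An artin `R`-algebra is an `R`-algebra that is finitely generated as an `R`-module, over a
commutative artinian ring `R`. As the opposite of an artin `R`-algebra is again one, the
quantification over all `Λ` covers right modules as well as left modules. -/

/-- The Wakamatsu tilting conjecture over `R`: every Wakamatsu tilting module of finite projective
dimension over an artin `R`-algebra is tilting. -/
def WakamatsuTiltingConjecture (R : Type u) [CommRing R] : Prop :=
  ∀ (Λ : Type u) [Ring Λ] [Algebra R Λ] [Module.Finite R Λ] (T : ModuleCat.{u} Λ),
    IsWakamatsuTilting T → FinitePD T → IsTilting T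

/-- Gorenstein symmetry for exact categories over `R`: in a Hom-finite Krull–Schmidt exact
`R`-category with a progenerator `P` and an injective cogenerator `I`, if `I` has finite projective
dimension then `P` has finite injective dimension. -/
def ExactGorensteinSymmetry (R : Type u) [CommRing R] : Prop :=
  ∀ (E : Type (u + 1)) [Category.{u} E] [Preadditive E] [Linear R E] [HasFiniteBiproducts E]
    (𝓔 : ExactStructure E), IsHomFinite R E → IsKrullSchmidt E →
    ∀ P I : E, 𝓔.IsProgenerator P → 𝓔.IsInjectiveCogenerator I →
      𝓔.FiniteProjDim I → 𝓔.FiniteInjDim P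

/-- Upward closedness of tilting modules over `R`: for Wakamatsu tilting modules `T` and `U` over
an artin `R`-algebra with `T ∈ 𝒳_U` and `U ∈ 𝒴_T`, if `U` is tilting then so is `T`. -/
def TiltingUpwardClosed (R : Type u) [CommRing R] : Prop :=
  ∀ (Λ : Type u) [Ring Λ] [Algebra R Λ] [Module.Finite R Λ] (T U : ModuleCat.{u} Λ),
    IsWakamatsuTilting T → IsWakamatsuTilting U → ClassX U T → ClassY T U →
      IsTilting U → IsTilting T

end WTilt

/-! Both directions translate between exact categories and modules.

From (GS) to tilting. Let `T` and `U` be self-orthogonal with `T ∈ 𝒳_U` and `U ∈ 𝒴_T`. The class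
`𝒳_U ∩ 𝒴_T` is closed under extensions and retracts, so it is a Hom-finite Krull–Schmidt exact
category, with progenerator `T` and injective cogenerator `U`. If `U` has finite projective
dimension over `Λ`, it also has one in this category: kernels of `add T`-covers stay in the class,
and high Ext groups from `U` into `T^⊥` vanish. By (GS), `T` has a finite injective resolution
there, that is, a finite coresolution by `add U`
(`ExactGorensteinSymmetry.exists_hasFiniteCoresolution`). The case `T = Λ`, where `𝒴_Λ` is the class
of all finitely generated modules, is (WTC). For (UP), the coresolution bounds the projective
dimension of `T`, and (WTC) applies to `T`.

From (WTC) to (GS). The functor `Hom(P, -)` embeds `E` fully, faithfully and exactly into modules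
over `(End P)ᵐᵒᵖ` and sends `P` to the regular module. Enough injectives make `Hom(P, I)` Wakamatsu
tilting, and its projective dimension is at most that of `I`. By (WTC) the regular module has a
finite coresolution by `add Hom(P, I)`. Since injectives of `E` stay Ext-acyclic against the image
of `E`, dimension shifting bounds the injective dimension of `P`.

The technical core is the closure of `𝒳_T` under extensions, kernels of epimorphisms and retracts.
It is proved by coinduction: `Cogenerated` asks for a class containing the object and stable under
one embedding step, so only a single step is ever constructed. The facts on `𝒴_T` follow by passing
to the opposite category. -/

namespace WTilt

/-! ### Additive closures -/

section Additive

variable {C : Type*} [Category* C] [Preadditive C] [HasFiniteBiproducts C]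

/-- Membership in `add T`, expressed by a decomposition of the identity. -/
lemma inAdd_iff_exists_sum {T X : C} :
    InAdd T X ↔ ∃ (n : ℕ) (i : Fin n → (X ⟶ T)) (p : Fin n → (T ⟶ X)), ∑ k, i k ≫ p k = 𝟙 X := by
  constructor
  · rintro ⟨n, ⟨r⟩⟩
    refine ⟨n, fun k => r.i ≫ biproduct.π _ k, fun k => biproduct.ι (fun _ : Fin n => T) k ≫ r.r, ?_⟩
    have h := congr_arg (fun t => r.i ≫ t ≫ r.r) (biproduct.total (f := fun _ : Fin n => T))
    simp only [Preadditive.comp_sum, Preadditive.sum_comp, Category.id_comp, r.retract] at h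
    simpa only [Category.assoc] using h
  · rintro ⟨n, i, p, h⟩
    exact ⟨n, ⟨⟨biproduct.lift i, biproduct.desc p, by rw [biproduct.lift_desc, h]⟩⟩⟩

lemma InAdd.of_fintype_sum {T X : C} {J : Type*} [Fintype J] (i : J → (X ⟶ T)) (p : J → (T ⟶ X))
    (h : ∑ k, i k ≫ p k = 𝟙 X) : InAdd T X := by
  refine inAdd_iff_exists_sum.2 ⟨Fintype.card J, fun k => i ((Fintype.equivFin J).symm k),
    fun k => p ((Fintype.equivFin J).symm k), ?_⟩
  rw [← h]
  exact Equiv.sum_comp (Fintype.equivFin J).symm (fun k => i k ≫ p k)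

lemma InAdd.refl (T : C) : InAdd T T :=
  InAdd.of_fintype_sum (J := Unit) (fun _ => 𝟙 T) (fun _ => 𝟙 T) (by simp)

lemma InAdd.of_isZero {T X : C} (h : IsZero X) : InAdd T X :=
  InAdd.of_fintype_sum (J := Empty) (fun k => k.elim) (fun k => k.elim) (h.eq_of_src _ _)

lemma InAdd.of_retract {T X Y : C} (hY : InAdd T Y) (r : Retract X Y) : InAdd T X := by
  obtain ⟨n, ⟨s⟩⟩ := hY
  exact ⟨n, ⟨r.trans s⟩⟩

lemma InAdd.of_splitting {T : C} {S : ShortComplex C} (s : S.Splitting) (h₁ : InAdd T S.X₁)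
    (h₃ : InAdd T S.X₃) : InAdd T S.X₂ := by
  obtain ⟨m, i, p, hi⟩ := inAdd_iff_exists_sum.1 h₁
  obtain ⟨n, j, q, hj⟩ := inAdd_iff_exists_sum.1 h₃
  refine InAdd.of_fintype_sum (J := Fin m ⊕ Fin n) (Sum.elim (fun k => s.r ≫ i k) fun k => S.g ≫ j k)
    (Sum.elim (fun k => p k ≫ S.f) fun k => q k ≫ s.s) ?_
  have e₁ : ∑ k, (s.r ≫ i k) ≫ p k ≫ S.f = s.r ≫ S.f := by
    have := congr_arg (fun t => s.r ≫ t ≫ S.f) hi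
    simpa [Preadditive.comp_sum, Preadditive.sum_comp] using this
  have e₂ : ∑ k, (S.g ≫ j k) ≫ q k ≫ s.s = S.g ≫ s.s := by
    have := congr_arg (fun t => S.g ≫ t ≫ s.s) hj
    simpa [Preadditive.comp_sum, Preadditive.sum_comp] using this
  rw [Fintype.sum_sum_type]
  simp only [Sum.elim_inl, Sum.elim_inr]
  rw [e₁, e₂, s.id]

lemma InAdd.map {D : Type*} [Category* D] [Preadditive D] [HasFiniteBiproducts D] (F : C ⥤ D)
    [F.Additive] {T X : C} (h : InAdd T X) : InAdd (F.obj T) (F.obj X) := by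
  obtain ⟨n, i, p, hi⟩ := inAdd_iff_exists_sum.1 h
  refine inAdd_iff_exists_sum.2 ⟨n, fun k => F.map (i k), fun k => F.map (p k), ?_⟩
  simp_rw [← F.map_comp, ← F.map_sum, hi, F.map_id]

lemma InAdd.of_map {D : Type*} [Category* D] [Preadditive D] [HasFiniteBiproducts D] (F : C ⥤ D)
    [F.Additive] [F.Full] [F.Faithful] {T X : C} (h : InAdd (F.obj T) (F.obj X)) : InAdd T X := by
  obtain ⟨n, i, p, hi⟩ := inAdd_iff_exists_sum.1 h
  refine inAdd_iff_exists_sum.2 ⟨n, fun k => F.preimage (i k), fun k => F.preimage (p k), ?_⟩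
  apply F.map_injective
  simp [F.map_sum, hi]

lemma InAdd.trans {T X Y : C} (hY : InAdd T X) (h : InAdd X Y) : InAdd T Y := by
  obtain ⟨n, i, p, hi⟩ := inAdd_iff_exists_sum.1 h
  obtain ⟨m, j, q, hj⟩ := inAdd_iff_exists_sum.1 hY
  refine InAdd.of_fintype_sum (J := Fin n × Fin m) (fun k => i k.1 ≫ j k.2)
    (fun k => q k.2 ≫ p k.1) ?_
  rw [Fintype.sum_prod_type, ← hi]
  refine Finset.sum_congr rfl fun a _ => ?_
  have := congr_arg (fun t => i a ≫ t ≫ p a) hj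
  simpa [Preadditive.comp_sum, Preadditive.sum_comp] using this

end Additive

/-! ### Short exact sequences of kernels and cokernels -/

section Abelian

variable {A : Type*} [Category* A] [Abelian A]

lemma shortExact_of_isColimit {S : ShortComplex A} [Mono S.f]
    (h : IsColimit (CokernelCofork.ofπ S.g S.zero)) : S.ShortExact where
  exact := S.exact_of_g_is_cokernel h
  epi_g := epi_of_isColimit_cofork h

lemma shortExact_of_isLimit {S : ShortComplex A} [Epi S.g]
    (h : IsLimit (KernelFork.ofι S.f S.zero)) : S.ShortExact where
  exact := S.exact_of_f_is_kernel h
  mono_f := mono_of_isLimit_fork h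

lemma shortExact_cokernel {X Y : A} (f : X ⟶ Y) [Mono f] :
    (ShortComplex.mk f (cokernel.π f) (cokernel.condition f)).ShortExact :=
  shortExact_of_isColimit (cokernelIsCokernel f)

lemma shortExact_kernel {X Y : A} (f : X ⟶ Y) [Epi f] :
    (ShortComplex.mk (kernel.ι f) f (kernel.condition f)).ShortExact :=
  shortExact_of_isLimit (kernelIsKernel f)

/-- The cokernels of two composable monomorphisms and of their composition form a short exact
sequence. -/
lemma shortExact_cokernel_comp {X Y Z : A} (f : X ⟶ Y) (g : Y ⟶ Z) [Mono f] [Mono g] :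
    (ShortComplex.mk (cokernel.map f (f ≫ g) (𝟙 _) g (by simp))
      (cokernel.map (f ≫ g) g f (𝟙 _) (by simp)) (by aesop)).ShortExact where
  exact := (kernelCokernelCompSequence_exact f g).exact 3
  mono_f := ((kernelCokernelCompSequence_exact f g).exact 2).mono_g
    ((IsZero.of_iso (isZero_zero _) (kernel.ofMono g)).eq_of_src _ _)
  epi_g := inferInstanceAs (Epi ((kernelCokernelCompSequence f g).map' 4 5))

/-- The kernels of two composable epimorphisms and of their composition form a short exact
sequence. -/
lemma shortExact_kernel_comp {X Y Z : A} (f : X ⟶ Y) (g : Y ⟶ Z) [Epi f] [Epi g] :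
    (ShortComplex.mk (kernel.map f (f ≫ g) (𝟙 _) g (by simp))
      (kernel.map (f ≫ g) g f (𝟙 _) (by simp)) (by aesop)).ShortExact where
  exact := (kernelCokernelCompSequence_exact f g).exact 0
  mono_f := inferInstanceAs (Mono ((kernelCokernelCompSequence f g).map' 0 1))
  epi_g := ((kernelCokernelCompSequence_exact f g).exact 1).epi_f
    ((IsZero.of_iso (isZero_zero _) (cokernel.ofEpi f)).eq_of_tgt _ _)

lemma prop_cokernel_iff_of_shortExact (P : ObjectProperty A) [P.IsClosedUnderIsomorphisms]
    {S : ShortComplex A} (hS : S.ShortExact) : P (cokernel S.f) ↔ P S.X₃ :=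
  P.prop_iff_of_iso ((cokernelIsCokernel S.f).coconePointUniqueUpToIso hS.gIsCokernel)

lemma prop_kernel_iff_of_shortExact (P : ObjectProperty A) [P.IsClosedUnderIsomorphisms]
    {S : ShortComplex A} (hS : S.ShortExact) : P (kernel S.g) ↔ P S.X₁ :=
  P.prop_iff_of_iso ((kernelIsKernel S.g).conePointUniqueUpToIso hS.fIsKernel)

end Abelian

/-! ### The exact structure on an extension-closed subcategory -/

section ExtensionClosed

variable {A : Type*} [Category* A] [Abelian A] (P : ObjectProperty A)

instance hasFiniteBiproducts_fullSubcategory [P.IsClosedUnderExtensions]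
    [P.IsClosedUnderIsomorphisms] [P.ContainsZero] : HasFiniteBiproducts P.FullSubcategory := by
  have : P.IsClosedUnderBinaryProducts := ⟨by
    rintro X ⟨p⟩
    let e : p.diag.obj ⟨.left⟩ ⊞ p.diag.obj ⟨.right⟩ ≅ X :=
      (BinaryBiproduct.isLimit _ _).conePointUniqueUpToIso
        ((IsLimit.postcomposeHomEquiv (diagramIsoPair p.diag) _).symm p.isLimit)
    exact P.prop_of_iso e (P.prop_biprod (p.prop_diag_obj _) (p.prop_diag_obj _))⟩
  have : P.IsClosedUnderFiniteProducts := .mk'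
  exact HasFiniteBiproducts.of_hasFiniteProducts

instance additive_ι : P.ι.Additive where

/-- A short complex of the full subcategory is a conflation of the induced exact structure when it
is short exact in the ambient abelian category. -/
abbrev IsConflation (S : ShortComplex P.FullSubcategory) : Prop := (S.map P.ι).ShortExact

lemma exists_conflation_of_mono {X Y : P.FullSubcategory} (i : X ⟶ Y) [Mono i.hom]
    (h : P (cokernel i.hom)) :
    ∃ (W : P.FullSubcategory) (g : Y ⟶ W) (h : i ≫ g = 0), IsConflation P (.mk i g h) :=
  ⟨⟨_, h⟩, P.homMk (cokernel.π i.hom), by ext; exact cokernel.condition _,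
    shortExact_cokernel i.hom⟩

lemma exists_conflation_of_epi {X Y : P.FullSubcategory} (p : X ⟶ Y) [Epi p.hom]
    (h : P (kernel p.hom)) :
    ∃ (W : P.FullSubcategory) (f : W ⟶ X) (h : f ≫ p = 0), IsConflation P (.mk f p h) :=
  ⟨⟨_, h⟩, P.homMk (kernel.ι p.hom), by ext; exact kernel.condition _, shortExact_kernel p.hom⟩

lemma IsConflation.mono {S : ShortComplex P.FullSubcategory} (h : IsConflation P S) :
    Mono S.f.hom := h.mono_f

lemma IsConflation.epi {S : ShortComplex P.FullSubcategory} (h : IsConflation P S) :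
    Epi S.g.hom := h.epi_g

lemma IsConflation.prop_cokernel [P.IsClosedUnderIsomorphisms]
    {S : ShortComplex P.FullSubcategory} (h : IsConflation P S) :
    P (cokernel S.f.hom) := (prop_cokernel_iff_of_shortExact P h).2 S.X₃.property

lemma IsConflation.prop_kernel [P.IsClosedUnderIsomorphisms]
    {S : ShortComplex P.FullSubcategory} (h : IsConflation P S) :
    P (kernel S.g.hom) := (prop_kernel_iff_of_shortExact P h).2 S.X₁.property

/-- The exact structure on an extension-closed full subcategory of an abelian category. -/
noncomputable def extensionClosedExactStructure [P.IsClosedUnderExtensions]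
    [P.IsClosedUnderIsomorphisms] [P.ContainsZero] : ExactStructure P.FullSubcategory where
  conflation := IsConflation P
  of_iso e h := ShortComplex.shortExact_of_iso (P.ι.mapShortComplex.mapIso e) h
  isKernel {S} h :=
    have := h.mono_f
    have : Mono S.f := P.ι.mono_of_mono_map this
    ⟨KernelFork.IsLimit.ofι' _ _ fun {Z} k hk =>
    ⟨P.homMk (h.exact.lift k.hom (congr_arg (·.hom) hk)), by
      ext; exact h.exact.lift_f k.hom (congr_arg (·.hom) hk)⟩⟩
  isCokernel {S} h :=
    have := h.epi_g
    have : Epi S.g := P.ι.epi_of_epi_map this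
    ⟨CokernelCofork.IsColimit.ofπ' _ _ fun {Z} k hk =>
    ⟨P.homMk (h.exact.desc k.hom (congr_arg (·.hom) hk)), by
      ext; exact h.exact.g_desc k.hom (congr_arg (·.hom) hk)⟩⟩
  inflation_id X :=
    have : Mono (InducedCategory.Hom.hom (𝟙 X)) := inferInstanceAs (Mono (𝟙 X.obj))
    exists_conflation_of_mono P (𝟙 X)
      (P.prop_of_isZero (IsZero.of_iso (isZero_zero _) (cokernel.ofEpi (𝟙 X.obj))))
  deflation_id X :=
    have : Epi (InducedCategory.Hom.hom (𝟙 X)) := inferInstanceAs (Epi (𝟙 X.obj))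
    exists_conflation_of_epi P (𝟙 X)
      (P.prop_of_isZero (IsZero.of_iso (isZero_zero _) (kernel.ofMono (𝟙 X.obj))))
  inflation_comp := by
    rintro X Y Z i j ⟨_, _, _, hi⟩ ⟨_, _, _, hj⟩
    have := hi.mono
    have := hj.mono
    dsimp at *
    have : Mono (i ≫ j).hom := mono_comp i.hom j.hom
    -- The cokernel of the composite is an extension of the two cokernels.
    exact exists_conflation_of_mono P _ (P.prop_X₂_of_shortExact
      (shortExact_cokernel_comp i.hom j.hom) hi.prop_cokernel hj.prop_cokernel)
  deflation_comp := by
    rintro X Y Z i j ⟨_, _, _, hi⟩ ⟨_, _, _, hj⟩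
    have := hi.epi
    have := hj.epi
    dsimp at *
    have : Epi (i ≫ j).hom := epi_comp i.hom j.hom
    exact exists_conflation_of_epi P _ (P.prop_X₂_of_shortExact
      (shortExact_kernel_comp i.hom j.hom) hi.prop_kernel hj.prop_kernel)
  inflation_pushout := by
    rintro X Y X' i a ⟨_, _, _, hi⟩
    have := hi.mono
    dsimp at this
    -- A pushout preserves the cokernel, so the new object is an extension of that cokernel by `X'`.
    have sq := IsPushout.of_hasPushout i.hom a.hom
    have := isIso_cokernel_map_of_isPushout sq
    have hc : P (cokernel (pushout.inr i.hom a.hom)) :=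
      P.prop_of_iso (asIso (cokernel.map _ _ _ _ sq.w)) hi.prop_cokernel
    have hY : P (pushout i.hom a.hom) :=
      P.prop_X₂_of_shortExact (shortExact_cokernel (pushout.inr i.hom a.hom)) X'.property hc
    refine ⟨⟨_, hY⟩, P.homMk (pushout.inl i.hom a.hom), P.homMk (pushout.inr i.hom a.hom), ?_, ?_⟩
    · exact IsPushout.of_map P.ι (by ext; exact sq.w) sq
    · have : Mono (pushout.inr i.hom a.hom) := inferInstance
      exact @exists_conflation_of_mono _ _ _ P X' ⟨_, hY⟩
        (P.homMk (pushout.inr i.hom a.hom)) this hc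
  deflation_pullback := by
    rintro Y Z Z' p c ⟨_, _, _, hp⟩
    have := hp.epi
    dsimp at this
    have sq := IsPullback.of_hasPullback p.hom c.hom
    have := isIso_kernel_map_of_isPullback sq.flip
    have hc : P (kernel (pullback.snd p.hom c.hom)) :=
      P.prop_of_iso (asIso (kernel.map _ _ _ _ sq.flip.w)).symm hp.prop_kernel
    have hY : P (pullback p.hom c.hom) :=
      P.prop_X₂_of_shortExact (shortExact_kernel (pullback.snd p.hom c.hom)) hc Z'.property
    refine ⟨⟨_, hY⟩, P.homMk (pullback.fst p.hom c.hom), P.homMk (pullback.snd p.hom c.hom), ?_, ?_⟩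
    · exact IsPullback.of_map P.ι (by ext; exact sq.w) sq
    · have : Epi (pullback.snd p.hom c.hom) := inferInstance
      exact @exists_conflation_of_epi _ _ _ P ⟨_, hY⟩ Z'
        (P.homMk (pullback.snd p.hom c.hom)) this hc

end ExtensionClosed

/-! ### Coinductive classes of objects with infinite (co)resolutions -/

section Cogenerated

variable {A : Type*} [Category* A] [Abelian A]

/-- `Y` embeds into an object of `T` with cokernel in `Q`. -/
def EmbedsWithCokernel (T Q : ObjectProperty A) (Y : A) : Prop :=
  ∃ (V Z : A) (f : Y ⟶ V) (g : V ⟶ Z) (h : f ≫ g = 0),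
    (ShortComplex.mk f g h).ShortExact ∧ T V ∧ Q Z

/-- The objects having a coresolution by objects of `T` all of whose cosyzygies are in `P`. -/
def Cogenerated (P T : ObjectProperty A) : ObjectProperty A := fun X =>
  ∃ Q : ObjectProperty A, Q X ∧ Q ≤ P ∧ ∀ Y, Q Y → EmbedsWithCokernel T Q Y

/-- `Y` is covered by an object of `T` with kernel in `Q`. -/
def CoveredWithKernel (T Q : ObjectProperty A) (Y : A) : Prop :=
  ∃ (Z V : A) (f : Z ⟶ V) (g : V ⟶ Y) (h : f ≫ g = 0),
    (ShortComplex.mk f g h).ShortExact ∧ T V ∧ Q Z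

/-- The objects having a resolution by objects of `T` all of whose syzygies are in `P`. -/
def Generated (P T : ObjectProperty A) : ObjectProperty A := fun X =>
  ∃ Q : ObjectProperty A, Q X ∧ Q ≤ P ∧ ∀ Y, Q Y → CoveredWithKernel T Q Y

lemma EmbedsWithCokernel.mono {T Q Q' : ObjectProperty A} (h : Q ≤ Q') {Y : A}
    (hY : EmbedsWithCokernel T Q Y) : EmbedsWithCokernel T Q' Y := by
  obtain ⟨V, Z, f, g, w, hs, hV, hZ⟩ := hY
  exact ⟨V, Z, f, g, w, hs, hV, h _ hZ⟩

lemma Cogenerated.le (P T : ObjectProperty A) : Cogenerated P T ≤ P := by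
  rintro X ⟨Q, hX, hQ, -⟩
  exact hQ _ hX

lemma Cogenerated.embeds {P T : ObjectProperty A} {X : A} (h : Cogenerated P T X) :
    EmbedsWithCokernel T (Cogenerated P T) X := by
  obtain ⟨Q, hX, hQ, hs⟩ := h
  exact (hs X hX).mono fun Y hY => ⟨Q, hY, hQ, hs⟩

/-- Coinduction up to the class of cogenerated objects. -/
lemma Cogenerated.of_embeds {P T Q : ObjectProperty A} (hQ : Q ≤ P)
    (h : ∀ Y, Q Y → EmbedsWithCokernel T (Q ⊔ Cogenerated P T) Y) : Q ≤ Cogenerated P T := by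
  intro X hX
  refine ⟨Q ⊔ Cogenerated P T, Or.inl hX, sup_le hQ (Cogenerated.le P T), ?_⟩
  rintro Y (hY | hY)
  · exact h Y hY
  · exact hY.embeds.mono le_sup_right

/-- `T` consists of relative injectives for the class `P`, which is closed under extensions,
kernels of epimorphisms and retracts. -/
structure IsCogeneratingPair (P T : ObjectProperty A) : Prop where
  le : T ≤ P
  of_isZero : ∀ Z : A, IsZero Z → T Z
  of_splitting : ∀ (S : ShortComplex A) (_ : S.Splitting), T S.X₁ → T S.X₃ → T S.X₂
  prop_X₂ : ∀ S : ShortComplex A, S.ShortExact → P S.X₁ → P S.X₃ → P S.X₂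
  prop_X₁ : ∀ S : ShortComplex A, S.ShortExact → P S.X₂ → P S.X₃ → P S.X₁
  of_retract : ∀ (X Y : A) (_ : Retract X Y), P Y → P X
  exists_extension : ∀ S : ShortComplex A, S.ShortExact → P S.X₃ → ∀ V : A, T V →
    ∀ a : S.X₁ ⟶ V, ∃ b : S.X₂ ⟶ V, S.f ≫ b = a

/-- `T` consists of relative projectives for the class `P`, which is closed under extensions,
cokernels of monomorphisms and retracts. -/
structure IsGeneratingPair (P T : ObjectProperty A) : Prop where
  le : T ≤ P
  of_isZero : ∀ Z : A, IsZero Z → T Z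
  of_splitting : ∀ (S : ShortComplex A) (_ : S.Splitting), T S.X₁ → T S.X₃ → T S.X₂
  prop_X₂ : ∀ S : ShortComplex A, S.ShortExact → P S.X₁ → P S.X₃ → P S.X₂
  prop_X₃ : ∀ S : ShortComplex A, S.ShortExact → P S.X₁ → P S.X₂ → P S.X₃
  of_retract : ∀ (X Y : A) (_ : Retract X Y), P Y → P X
  exists_lift : ∀ S : ShortComplex A, S.ShortExact → P S.X₁ → ∀ V : A, T V →
    ∀ a : V ⟶ S.X₃, ∃ b : V ⟶ S.X₂, b ≫ S.g = a

lemma shortExact_biprod_map_id {Y V Z : A} (W : A) {f : Y ⟶ V} {g : V ⟶ Z} {h : f ≫ g = 0}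
    (hS : (ShortComplex.mk f g h).ShortExact) :
    (ShortComplex.mk (biprod.map (𝟙 W) f) (biprod.snd ≫ g) (by simp [h])).ShortExact := by
  have := hS.mono_f
  have := hS.epi_g
  dsimp at *
  have : Mono (ShortComplex.mk (biprod.map (𝟙 W) f) (biprod.snd ≫ g) (by simp [h])).f :=
    inferInstanceAs (Mono (biprod.map (𝟙 W) f))
  refine shortExact_of_isColimit (CokernelCofork.IsColimit.ofπ _ _
    (fun k hk => hS.exact.desc (biprod.inr ≫ k) ?_) (fun k hk => ?_) fun k hk m hm => ?_)
  · simpa using congr_arg (fun t => biprod.inr ≫ t) hk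
  · have e : biprod.inl ≫ k = 0 := by simpa using congr_arg (fun t => biprod.inl ≫ t) hk
    have := hS.exact.g_desc (biprod.inr ≫ k) (by simpa using congr_arg (fun t => biprod.inr ≫ t) hk)
    dsimp at this ⊢
    ext
    · simp [e]
    · simp [this]
  · have := hS.exact.g_desc (biprod.inr ≫ k) (by simpa using congr_arg (fun t => biprod.inr ≫ t) hk)
    dsimp at this hm
    rw [← cancel_epi g, this, ← hm]
    simp

variable {P T : ObjectProperty A}

open ZeroObject in
lemma IsCogeneratingPair.le_cogenerated (h : IsCogeneratingPair P T) : T ≤ Cogenerated P T := by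
  refine Cogenerated.of_embeds h.le fun Y hY => ⟨Y, 0, 𝟙 Y, 0, by simp, ?_, hY, .inl ?_⟩
  · exact (ShortComplex.Splitting.ofIsIsoOfIsZero _
      (inferInstanceAs (IsIso (𝟙 Y))) (isZero_zero A)).shortExact
  · exact h.of_isZero _ (isZero_zero A)

lemma IsCogeneratingPair.isClosedUnderIsomorphisms_cogenerated (h : IsCogeneratingPair P T) :
    (Cogenerated P T).IsClosedUnderIsomorphisms where
  of_iso {X Y} e hX := by
    let Q : ObjectProperty A := fun Y => ∃ X, Cogenerated P T X ∧ Nonempty (X ≅ Y)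
    refine Cogenerated.of_embeds (Q := Q) ?_ ?_ _ ⟨X, hX, ⟨e⟩⟩
    · rintro Y ⟨X, hX, ⟨e⟩⟩
      exact h.of_retract Y X (Retract.ofIso e.symm) (Cogenerated.le P T _ hX)
    · rintro Y ⟨X, hX, ⟨e⟩⟩
      obtain ⟨V, Z, f, g, w, hV, hTV, hZ⟩ := hX.embeds
      exact ⟨V, Z, e.inv ≫ f, g, by simp [w], ShortComplex.shortExact_of_iso
        (ShortComplex.isoMk (S₁ := .mk f g w) e (Iso.refl _) (Iso.refl _) (by simp) (by simp)) hV, hTV, .inr hZ⟩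

/-- One step of the horseshoe construction. Relative injectivity extends `X₁ ⟶ V` to `X₂`, which
embeds `X₂` in `V ⊞ X₃` and then in `V ⊞ W`. The final cokernel is an extension of the cosyzygy `Z'`
of `X₃` by the cosyzygy `X'` of `X₁`, so it is again of the shape covered by the coinduction. -/
lemma IsCogeneratingPair.cogenerated_X₂ (h : IsCogeneratingPair P T) {S : ShortComplex A}
    (hS : S.ShortExact)
    (h₁ : Cogenerated P T S.X₁) (h₃ : Cogenerated P T S.X₃) : Cogenerated P T S.X₂ := by
  let Q : ObjectProperty A := fun Y => ∃ S : ShortComplex A, S.ShortExact ∧ Cogenerated P T S.X₁ ∧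
    Cogenerated P T S.X₃ ∧ S.X₂ = Y
  refine Cogenerated.of_embeds (Q := Q) ?_ ?_ _ ⟨S, hS, h₁, h₃, rfl⟩
  · rintro _ ⟨S, hS, h₁, h₃, rfl⟩
    exact h.prop_X₂ S hS (Cogenerated.le P T _ h₁) (Cogenerated.le P T _ h₃)
  · rintro _ ⟨S, hS, h₁, h₃, rfl⟩
    obtain ⟨V, X', f, g, w, hV, hTV, hX'⟩ := h₁.embeds
    obtain ⟨W, Z', f', g', w', hW, hTW, hZ'⟩ := h₃.embeds
    obtain ⟨a, ha⟩ := h.exists_extension S hS (Cogenerated.le P T _ h₃) V hTV f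
    have := hS.mono_f
    have := hS.epi_g
    have := hV.mono_f
    have := hW.mono_f
    dsimp at *
    let j : S.X₂ ⟶ V ⊞ S.X₃ := biprod.lift a S.g
    have : Mono j := by
      refine Preadditive.mono_of_cancel_zero _ fun t ht => ?_
      have h₁ : t ≫ S.g = 0 := by simpa [j] using congr_arg (fun u => u ≫ biprod.snd) ht
      have h₂ : t ≫ a = 0 := by simpa [j] using congr_arg (fun u => u ≫ biprod.fst) ht
      have h₃ := hS.exact.lift_f t h₁
      rw [← h₃, Category.assoc, ha] at h₂
      rw [← h₃, zero_of_comp_mono _ h₂, zero_comp]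
    -- This pushout square identifies the cokernel of `j` with that of `f`.
    have sq : IsPushout S.f f j biprod.inl := by
      refine ⟨⟨by ext <;> simp [j, ha]⟩, ⟨PushoutCocone.IsColimit.mk _
        (fun s => biprod.desc s.inr (hS.exact.desc (s.inl - a ≫ s.inr) ?_)) ?_ ?_ ?_⟩⟩
      · simp [reassoc_of% ha, s.condition]
      · intro s
        simp [j, hS.exact.g_desc]
      · intro s
        simp
      · intro s m h₁ h₂
        ext
        · simpa using h₂
        · rw [← cancel_epi S.g]
          simp only [biprod.inr_desc, hS.exact.g_desc]
          rw [← h₁, ← h₂]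
          simp only [← Category.assoc, ← Preadditive.sub_comp]
          congr 1
          ext <;> simp [j]
    have := isIso_cokernel_map_of_isPushout sq.flip
    have := h.isClosedUnderIsomorphisms_cogenerated
    exact ⟨V ⊞ W, _, j ≫ biprod.map (𝟙 V) f', cokernel.π _, cokernel.condition _,
      shortExact_cokernel _, h.of_splitting _ (ShortComplex.Splitting.ofHasBinaryBiproduct V W)
        hTV hTW, .inl ⟨_, shortExact_cokernel_comp j (biprod.map (𝟙 V) f'),
          ObjectProperty.prop_of_iso _ (asIso (cokernel.map _ _ _ _ sq.flip.w))
            ((prop_cokernel_iff_of_shortExact _ hV).2 hX'),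
          (prop_cokernel_iff_of_shortExact _ (shortExact_biprod_map_id V hW)).2 hZ', rfl⟩⟩

/-- Embed `X₁` in `V` through `X₂`: the cokernel is an extension of the cosyzygy of `X₂` by `X₃`,
hence already cogenerated. -/
lemma IsCogeneratingPair.cogenerated_X₁ (h : IsCogeneratingPair P T) {S : ShortComplex A}
    (hS : S.ShortExact)
    (h₂ : Cogenerated P T S.X₂) (h₃ : Cogenerated P T S.X₃) : Cogenerated P T S.X₁ := by
  let Q : ObjectProperty A := fun Y => Y = S.X₁
  refine Cogenerated.of_embeds (Q := Q) ?_ ?_ _ rfl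
  · rintro _ rfl
    exact h.prop_X₁ S hS (Cogenerated.le P T _ h₂) (Cogenerated.le P T _ h₃)
  · rintro _ rfl
    obtain ⟨V, Y', f, g, w, hV, hTV, hY'⟩ := h₂.embeds
    have := hS.mono_f
    have := hS.epi_g
    have := hV.mono_f
    dsimp at *
    have := h.isClosedUnderIsomorphisms_cogenerated
    exact ⟨V, _, S.f ≫ f, cokernel.π _, cokernel.condition _, shortExact_cokernel _, hTV,
      .inr (h.cogenerated_X₂ (shortExact_cokernel_comp S.f f)
        ((prop_cokernel_iff_of_shortExact _ hS).2 h₃)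
        ((prop_cokernel_iff_of_shortExact _ hV).2 hY'))⟩

/-- The cokernel of `X ⟶ Y ⟶ V` need not be a retract of the cosyzygy `W` of `Y`, but it is one of
`W ⊞ V`. This suffices, since `W ⊞ V` is cogenerated too. -/
lemma IsCogeneratingPair.cogenerated_of_retract (h : IsCogeneratingPair P T) {X Y : A}
    (hY : Cogenerated P T Y)
    (r : Retract X Y) : Cogenerated P T X := by
  let Q : ObjectProperty A := fun X => ∃ Y, Nonempty (Retract X Y) ∧ Cogenerated P T Y
  refine Cogenerated.of_embeds (Q := Q) ?_ ?_ _ ⟨Y, ⟨r⟩, hY⟩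
  · rintro X ⟨Y, ⟨r⟩, hY⟩
    exact h.of_retract X Y r (Cogenerated.le P T _ hY)
  · rintro X ⟨Y, ⟨r⟩, hY⟩
    obtain ⟨V, W, f, g, w, hV, hTV, hW⟩ := hY.embeds
    -- `e` extends to `V` the idempotent of `Y` with image `X`. The section below is `(g, 1 - e)`
    -- and the retraction is `(e, 1)`, read modulo `X`; they compose to `e + (1 - e) = 1`.
    obtain ⟨e, he⟩ := h.exists_extension _ hV (Cogenerated.le P T _ hW) V hTV (r.r ≫ r.i ≫ f)
    have := hV.mono_f
    have := hV.epi_g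
    dsimp at *
    refine ⟨V, _, r.i ≫ f, cokernel.π _, cokernel.condition _, shortExact_cokernel _, hTV,
      .inl ⟨W ⊞ V, ⟨?_⟩, ?_⟩⟩
    · let p := cokernel.π (r.i ≫ f)
      have hp : r.i ≫ f ≫ p = 0 := by
        rw [← Category.assoc]; exact cokernel.condition _
      have hep : f ≫ e ≫ p = 0 := by rw [reassoc_of% he, hp, comp_zero]
      let eW : W ⟶ cokernel (r.i ≫ f) := hV.exact.desc (e ≫ p) hep
      have hg : g ≫ eW = e ≫ p := hV.exact.g_desc (e ≫ p) hep
      refine ⟨biprod.lift (cokernel.desc _ g (by simp [w])) (cokernel.desc _ (𝟙 V - e) ?_),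
        biprod.desc eW p, ?_⟩
      · simp [he]
      · rw [← cancel_epi (cokernel.π (r.i ≫ f))]
        simp only [biprod.lift_desc, Preadditive.comp_add, cokernel.π_desc_assoc, hg,
          Preadditive.sub_comp, Category.id_comp, Category.comp_id]
        exact add_sub_cancel _ _
    · exact h.cogenerated_X₂ (ShortComplex.Splitting.ofHasBinaryBiproduct W V).shortExact hW
        (h.le_cogenerated V hTV)

lemma CoveredWithKernel.op {T Q : ObjectProperty A} {Y : A} (h : CoveredWithKernel T Q Y) :
    EmbedsWithCokernel T.op Q.op (.op Y) := by
  obtain ⟨Z, V, f, g, w, hs, hV, hZ⟩ := h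
  exact ⟨.op V, .op Z, g.op, f.op, by rw [← op_comp, w, op_zero], hs.op, hV, hZ⟩

lemma EmbedsWithCokernel.unop {T : ObjectProperty A} {Q : ObjectProperty Aᵒᵖ} {Y : Aᵒᵖ}
    (h : EmbedsWithCokernel T.op Q Y) : CoveredWithKernel T Q.unop Y.unop := by
  obtain ⟨V, Z, f, g, w, hs, hV, hZ⟩ := h
  exact ⟨Z.unop, V.unop, g.unop, f.unop, by rw [← unop_comp, w, unop_zero], hs.unop, hV, hZ⟩

/-- Transports every closure property of cogenerated classes to generated ones. -/
lemma generated_iff_cogenerated_op {X : A} :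
    Generated P T X ↔ Cogenerated P.op T.op (.op X) := by
  constructor
  · rintro ⟨Q, hX, hQ, hs⟩
    exact ⟨Q.op, hX, fun Y hY => hQ _ hY, fun Y hY => (hs _ hY).op⟩
  · rintro ⟨Q, hX, hQ, hs⟩
    exact ⟨Q.unop, hX, fun Y hY => hQ _ hY, fun Y hY => (hs _ hY).unop⟩

lemma IsGeneratingPair.op (h : IsGeneratingPair P T) : IsCogeneratingPair P.op T.op where
  le := fun X hX => h.le _ hX
  of_isZero Z hZ := h.of_isZero _ hZ.unop
  of_splitting S s h₁ h₃ := h.of_splitting S.unop s.unop h₃ h₁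
  prop_X₂ S hS h₁ h₃ := h.prop_X₂ S.unop hS.unop h₃ h₁
  prop_X₁ S hS h₂ h₃ := h.prop_X₃ S.unop hS.unop h₃ h₂
  of_retract X Y r hY := h.of_retract X.unop Y.unop ⟨r.r.unop, r.i.unop, by
    rw [← unop_comp, r.retract, unop_id]⟩ hY
  exists_extension S hS h₃ V hV a := by
    obtain ⟨b, hb⟩ := h.exists_lift S.unop hS.unop h₃ V.unop hV a.unop
    exact ⟨b.op, Quiver.Hom.unop_inj hb⟩

lemma Generated.le (P T : ObjectProperty A) : Generated P T ≤ P := by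
  rintro X ⟨Q, hX, hQ, -⟩
  exact hQ _ hX

lemma Generated.covered {X : A} (h : Generated P T X) :
    CoveredWithKernel T (Generated P T) X := by
  obtain ⟨Q, hX, hQ, hs⟩ := h
  obtain ⟨Z, V, f, g, w, h, hV, hZ⟩ := hs X hX
  exact ⟨Z, V, f, g, w, h, hV, Q, hZ, hQ, hs⟩

lemma IsGeneratingPair.le_generated (h : IsGeneratingPair P T) : T ≤ Generated P T :=
  fun _ hX => generated_iff_cogenerated_op.2 (h.op.le_cogenerated _ hX)

lemma IsGeneratingPair.generated_X₂ (h : IsGeneratingPair P T) {S : ShortComplex A}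
    (hS : S.ShortExact) (h₁ : Generated P T S.X₁) (h₃ : Generated P T S.X₃) :
    Generated P T S.X₂ :=
  generated_iff_cogenerated_op.2 (h.op.cogenerated_X₂ hS.op (generated_iff_cogenerated_op.1 h₃)
    (generated_iff_cogenerated_op.1 h₁))

lemma IsGeneratingPair.generated_X₃ (h : IsGeneratingPair P T) {S : ShortComplex A}
    (hS : S.ShortExact) (h₁ : Generated P T S.X₁) (h₂ : Generated P T S.X₂) :
    Generated P T S.X₃ :=
  generated_iff_cogenerated_op.2 (h.op.cogenerated_X₁ hS.op (generated_iff_cogenerated_op.1 h₂)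
    (generated_iff_cogenerated_op.1 h₁))

lemma IsGeneratingPair.generated_of_retract (h : IsGeneratingPair P T) {X Y : A}
    (hY : Generated P T Y) (r : Retract X Y) : Generated P T X :=
  generated_iff_cogenerated_op.2 (h.op.cogenerated_of_retract (generated_iff_cogenerated_op.1 hY)
    ⟨r.r.op, r.i.op, by rw [← op_comp, r.retract, op_id]⟩)

end Cogenerated

/-! ### Krull–Schmidt decompositions in Hom-finite categories -/

section KrullSchmidt

/-- Fitting's lemma inside the commutative artinian subalgebra `R[a]`. The powers of `x = a`
stabilise, `xⁿ = xⁿ⁺¹y`, so `e = (xy)ⁿ⁺¹` is idempotent. If `e = 0` then `a` is nilpotent and `1 -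
a` is a unit; if `e = 1` then `x` divides `1`. -/
lemma isLocalRing_of_idempotent_trivial (R : Type*) [CommRing R] [IsArtinianRing R] (B : Type*)
    [Ring B] [Nontrivial B] [Algebra R B] [Module.Finite R B]
    (h : ∀ e : B, IsIdempotentElem e → e = 0 ∨ e = 1) : IsLocalRing B := by
  refine IsLocalRing.of_isUnit_or_isUnit_one_sub_self fun a => ?_
  let S := Algebra.adjoin R {a}
  have : IsNoetherian R B := isNoetherian_of_isNoetherianRing_of_finite R B
  have : Module.Finite R S := Module.IsNoetherian.finite R S.toSubmodule
  have := Algebra.isMulCommutative_adjoin R (s := {a}) (by simp)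
  let : CommRing S := inferInstance
  have : IsArtinianRing S := .of_finite R S
  let x : S := ⟨a, Algebra.self_mem_adjoin_singleton R a⟩
  obtain ⟨n, y, hy⟩ := IsArtinian.exists_pow_succ_smul_dvd x (1 : S)
  have h₁ : x ^ (n + 1) * (x * y) = x ^ (n + 1) := by
    have : x ^ (n + 1) * y = x ^ n := by simpa using hy
    linear_combination x * this
  have h₂ : ∀ k, x ^ (n + 1) * (x * y) ^ k = x ^ (n + 1) := by
    intro k
    induction k with
    | zero => simp
    | succ k ih => rw [pow_succ (x * y), ← mul_assoc, ih, h₁]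
  let e : S := (x * y) ^ (n + 1)
  have he : IsIdempotentElem e := by
    have := h₂ (n + 1)
    change (x * y) ^ (n + 1) * (x * y) ^ (n + 1) = (x * y) ^ (n + 1)
    rw [mul_pow] at this ⊢
    linear_combination y ^ (n + 1) * this
  rcases h e (by simpa [IsIdempotentElem] using congr_arg Subtype.val he) with h0 | h1
  · right
    have he0 : e = 0 := Subtype.ext h0
    have hx : x ^ (n + 1) = 0 := by rw [← h₂ (n + 1)]; change _ * e = 0; rw [he0, mul_zero]
    have ha : IsNilpotent a := ⟨n + 1, congr_arg Subtype.val hx⟩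
    exact ha.isUnit_one_sub
  · left
    have he1 : e = 1 := Subtype.ext h1
    have hu : IsUnit x := by
      refine IsUnit.of_mul_eq_one (x ^ n * y ^ (n + 1)) ?_
      rw [← he1]
      change _ = (x * y) ^ (n + 1)
      ring
    exact hu.map S.val

variable {C : Type*} [Category* C] [Preadditive C]

/-- A finite direct sum decomposition of `X` into objects with local endomorphism rings. -/
def HasLocalDecomposition [HasFiniteBiproducts C] (X : C) : Prop :=
  ∃ (n : ℕ) (Y : Fin n → C), (∀ i, IsLocalRing (End (Y i))) ∧ Nonempty (X ≅ ⨁ Y)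

lemma HasLocalDecomposition.of_splitting [HasFiniteBiproducts C] {X A B : C} (i : A ⟶ X)
    (p : X ⟶ A) (j : B ⟶ X)
    (q : X ⟶ B) (hip : i ≫ p = 𝟙 A) (hjq : j ≫ q = 𝟙 B) (hiq : i ≫ q = 0) (hjp : j ≫ p = 0)
    (h : p ≫ i + q ≫ j = 𝟙 X) (hA : HasLocalDecomposition A) (hB : HasLocalDecomposition B) :
    HasLocalDecomposition X := by
  obtain ⟨m, Y, hY, ⟨a⟩⟩ := hA
  obtain ⟨n, Z, hZ, ⟨b⟩⟩ := hB
  let W : Fin m ⊕ Fin n → C := Sum.elim Y Z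
  let s : ∀ k, W k ⟶ X := Sum.rec (fun k => biproduct.ι Y k ≫ a.inv ≫ i)
    fun k => biproduct.ι Z k ≫ b.inv ≫ j
  let t : ∀ k, X ⟶ W k := Sum.rec (fun k => p ≫ a.hom ≫ biproduct.π Y k)
    fun k => q ≫ b.hom ≫ biproduct.π Z k
  have hself : ∀ k, s k ≫ t k = 𝟙 (W k) := by
    rintro (k | k)
    · have : (biproduct.ι Y k ≫ a.inv ≫ i) ≫ p ≫ a.hom ≫ biproduct.π Y k = 𝟙 (Y k) := by
        simp [reassoc_of% hip]
      exact this
    · have : (biproduct.ι Z k ≫ b.inv ≫ j) ≫ q ≫ b.hom ≫ biproduct.π Z k = 𝟙 (Z k) := by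
        simp [reassoc_of% hjq]
      exact this
  have hne : ∀ k l, k ≠ l → s k ≫ t l = 0 := by
    rintro (k | k) (l | l) hkl
    · have : (biproduct.ι Y k ≫ a.inv ≫ i) ≫ p ≫ a.hom ≫ biproduct.π Y l = 0 := by
        simp [reassoc_of% hip, biproduct.ι_π_ne Y (fun h => hkl (congr_arg Sum.inl h))]
      exact this
    · have : (biproduct.ι Y k ≫ a.inv ≫ i) ≫ q ≫ b.hom ≫ biproduct.π Z l = 0 := by
        simp [reassoc_of% hiq]
      exact this
    · have : (biproduct.ι Z k ≫ b.inv ≫ j) ≫ p ≫ a.hom ≫ biproduct.π Y l = 0 := by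
        simp [reassoc_of% hjp]
      exact this
    · have : (biproduct.ι Z k ≫ b.inv ≫ j) ≫ q ≫ b.hom ≫ biproduct.π Z l = 0 := by
        simp [reassoc_of% hjq, biproduct.ι_π_ne Z (fun h => hkl (congr_arg Sum.inr h))]
      exact this
  have htotal : ∑ k, t k ≫ s k = 𝟙 X := by
    have h₁ := congr_arg (fun t => p ≫ a.hom ≫ t ≫ a.inv ≫ i) (biproduct.total (f := Y))
    have h₂ := congr_arg (fun t => q ≫ b.hom ≫ t ≫ b.inv ≫ j) (biproduct.total (f := Z))
    simp only [Preadditive.comp_sum, Preadditive.sum_comp, Category.id_comp,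
      Iso.hom_inv_id_assoc, Category.assoc] at h₁ h₂
    rw [← h, ← h₁, ← h₂, Fintype.sum_sum_type]
    refine congr_arg₂ _ (Finset.sum_congr rfl fun k _ => ?_) (Finset.sum_congr rfl fun k _ => ?_)
    · have : (p ≫ a.hom ≫ biproduct.π Y k) ≫ biproduct.ι Y k ≫ a.inv ≫ i =
        p ≫ a.hom ≫ biproduct.π Y k ≫ biproduct.ι Y k ≫ a.inv ≫ i := by simp
      exact this
    · have : (q ≫ b.hom ≫ biproduct.π Z k) ≫ biproduct.ι Z k ≫ b.inv ≫ j =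
        q ≫ b.hom ≫ biproduct.π Z k ≫ biproduct.ι Z k ≫ b.inv ≫ j := by simp
      exact this
  have hW : ∀ k, IsLocalRing (End (W k)) := Sum.rec hY hZ
  let e : X ≅ ⨁ W :=
    { hom := biproduct.lift t
      inv := biproduct.desc s
      hom_inv_id := by rw [biproduct.lift_desc, htotal]
      inv_hom_id := by
        refine biproduct.hom_ext _ _ fun k => biproduct.hom_ext' _ _ fun l => ?_
        simp only [Category.assoc, biproduct.ι_desc_assoc, biproduct.lift_π, Category.id_comp]
        by_cases hkl : l = k
        · subst hkl
          rw [hself, biproduct.ι_π_self]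
        · rw [hne _ _ hkl, biproduct.ι_π_ne _ hkl] }
  exact ⟨m + n, fun k => W (finSumFinEquiv.symm k), fun k => hW _,
    ⟨e ≪≫ biproduct.whiskerEquiv finSumFinEquiv fun k => eqToIso (by simp)⟩⟩

/-- The map `a ↦ p ≫ a ≫ i` embeds `End A` in `End X`. Were it onto, the identity of `X` would lie
in its image, forcing `p ≫ i = 𝟙 X`. -/
lemma length_end_lt_of_splitting (R : Type*) [CommRing R] [IsArtinianRing R] [Linear R C] {X A : C}
    [Module.Finite R (X ⟶ X)] (i : A ⟶ X) (p : X ⟶ A) (hip : i ≫ p = 𝟙 A) (h : p ≫ i ≠ 𝟙 X) :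
    Module.length R (A ⟶ A) < Module.length R (X ⟶ X) := by
  let φ : (A ⟶ A) →ₗ[R] (X ⟶ X) := Linear.leftComp R X p ∘ₗ Linear.rightComp R A i
  have hφ : ∀ a, φ a = p ≫ a ≫ i := fun a => rfl
  have hinj : Function.Injective φ := by
    intro a b hab
    have := congr_arg (fun t => i ≫ t ≫ p) hab
    simpa [hφ, hip, reassoc_of% hip] using this
  rw [(LinearEquiv.ofInjective φ hinj).length_eq]
  refine Submodule.length_lt fun htop => h ?_
  obtain ⟨a, ha⟩ : 𝟙 X ∈ LinearMap.range φ := htop ▸ Submodule.mem_top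
  rw [hφ] at ha
  calc p ≫ i = (p ≫ i) ≫ p ≫ a ≫ i := by rw [ha, Category.comp_id]
    _ = 𝟙 X := by rw [Category.assoc, reassoc_of% hip, ha]

variable (C) in
/-- An idempotent complete Hom-finite category over an artinian ring is Krull–Schmidt. -/
lemma isKrullSchmidt_of_isHomFinite [HasFiniteBiproducts C] [IsIdempotentComplete C]
    (R : Type u) [CommRing R]
    [IsArtinianRing R] [Linear R C] (hfin : IsHomFinite R C) : IsKrullSchmidt C := by
  -- Well-founded induction on the length of `End X`: a nontrivial idempotent splits `X` into two
  -- summands whose endomorphism rings are strictly shorter.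
  have key : ∀ (l : ℕ∞) (X : C), Module.length R (X ⟶ X) = l → HasLocalDecomposition X := by
    intro l
    induction l using WellFoundedLT.induction with
    | ind l ih =>
      rintro X rfl
      have := hfin X X
      have : Module.Finite R (End X) := hfin X X
      by_cases h0 : 𝟙 X = 0
      · have hX : IsZero X := (IsZero.iff_id_eq_zero X).2 h0
        refine ⟨0, Fin.elim0, fun k => k.elim0, ⟨hX.iso ?_⟩⟩
        rw [IsZero.iff_id_eq_zero]
        exact biproduct.hom_ext _ _ fun k => k.elim0
      have : Nontrivial (End X) := ⟨𝟙 X, 0, h0⟩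
      by_cases htriv : ∀ e : End X, IsIdempotentElem e → e = 0 ∨ e = 1
      · exact ⟨1, fun _ => X, fun _ => isLocalRing_of_idempotent_trivial R _ htriv,
          ⟨(biproductUniqueIso (fun _ : Fin 1 => X)).symm⟩⟩
      · push Not at htriv
        obtain ⟨e, he, he0, he1⟩ := htriv
        change X ⟶ X at e
        replace he : e ≫ e = e := he
        obtain ⟨A, i, p, hip, hpi⟩ := IsIdempotentComplete.idempotents_split X e he
        obtain ⟨B, j, q, hjq, hqj⟩ := IsIdempotentComplete.idempotents_split X (𝟙 X - e)
          (Idempotents.idem_of_id_sub_idem e he)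
        have hie : i ≫ e = i := by rw [← hpi, reassoc_of% hip]
        have hep : e ≫ p = p := by rw [← hpi, Category.assoc, hip, Category.comp_id]
        have hq : q = (𝟙 X - e) ≫ q := by rw [← hqj, Category.assoc, hjq, Category.comp_id]
        have hj : j = j ≫ (𝟙 X - e) := by rw [← hqj, reassoc_of% hjq]
        refine HasLocalDecomposition.of_splitting i p j q hip hjq ?_ ?_ ?_
          (ih _ (length_end_lt_of_splitting R i p hip fun h => he1 (hpi.symm.trans h)) A rfl)
          (ih _ (length_end_lt_of_splitting R j q hjq fun h => he0 ?_) B rfl)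
        · rw [hq]
          simp [Preadditive.sub_comp, Preadditive.comp_sub, reassoc_of% hie]
        · rw [hj]
          simp [Preadditive.sub_comp, Preadditive.comp_sub, hep]
        · rw [hpi, hqj]
          exact add_sub_cancel _ _
        · rw [hqj] at h
          exact sub_eq_self.1 h
  exact fun X => key _ X rfl

end KrullSchmidt

lemma isIdempotentComplete_fullSubcategory {A : Type*} [Category* A] [IsIdempotentComplete A]
    (P : ObjectProperty A) (h : ∀ (X Y : A) (_ : Retract X Y), P Y → P X) :
    IsIdempotentComplete P.FullSubcategory where
  idempotents_split X p hp := by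
    obtain ⟨Y, i, e, hie, hei⟩ := IsIdempotentComplete.idempotents_split X.obj p.hom
      (congr_arg (·.hom) hp)
    exact ⟨⟨Y, h Y X.obj ⟨i, e, hie⟩ X.property⟩, P.homMk i, P.homMk e,
      by ext; exact hie, by ext; exact hei⟩

/-! ### Dimension shifting for Ext -/

section Ext

open Abelian

variable {A : Type*} [Category* A] [Abelian A] [HasExt.{w} A] {S : ShortComplex A}

lemma subsingleton_ext_X₂_left (hS : S.ShortExact) {Y : A} {i : ℕ}
    (h₁ : Subsingleton (Ext.{w} S.X₁ Y i)) (h₃ : Subsingleton (Ext.{w} S.X₃ Y i)) :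
    Subsingleton (Ext.{w} S.X₂ Y i) := by
  refine subsingleton_of_forall_eq 0 fun x => ?_
  obtain ⟨y, rfl⟩ := Ext.contravariant_sequence_exact₂ hS Y x (Subsingleton.elim _ _)
  rw [Subsingleton.elim y 0, Ext.comp_zero]

lemma subsingleton_ext_X₁_left (hS : S.ShortExact) {Y : A} {i : ℕ}
    (h₂ : Subsingleton (Ext.{w} S.X₂ Y i)) (h₃ : Subsingleton (Ext.{w} S.X₃ Y (i + 1))) :
    Subsingleton (Ext.{w} S.X₁ Y i) := by
  refine subsingleton_of_forall_eq 0 fun x => ?_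
  obtain ⟨y, rfl⟩ := Ext.contravariant_sequence_exact₁ hS Y x (add_comm 1 i) (Subsingleton.elim _ _)
  rw [Subsingleton.elim y 0, Ext.comp_zero]

lemma subsingleton_ext_X₃_left (hS : S.ShortExact) {Y : A} {i : ℕ}
    (h₁ : Subsingleton (Ext.{w} S.X₁ Y i)) (h₂ : Subsingleton (Ext.{w} S.X₂ Y (i + 1))) :
    Subsingleton (Ext.{w} S.X₃ Y (i + 1)) := by
  refine subsingleton_of_forall_eq 0 fun x => ?_
  obtain ⟨y, rfl⟩ := Ext.contravariant_sequence_exact₃ hS Y x (Subsingleton.elim _ _) (add_comm 1 i)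
  rw [Subsingleton.elim y 0, Ext.comp_zero]

lemma subsingleton_ext_X₂_right (hS : S.ShortExact) {X : A} {i : ℕ}
    (h₁ : Subsingleton (Ext.{w} X S.X₁ i)) (h₃ : Subsingleton (Ext.{w} X S.X₃ i)) :
    Subsingleton (Ext.{w} X S.X₂ i) := by
  refine subsingleton_of_forall_eq 0 fun x => ?_
  obtain ⟨y, rfl⟩ := Ext.covariant_sequence_exact₂ X hS x (Subsingleton.elim _ _)
  rw [Subsingleton.elim y 0, Ext.zero_comp]

lemma subsingleton_ext_X₃_right (hS : S.ShortExact) {X : A} {i : ℕ}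
    (h₁ : Subsingleton (Ext.{w} X S.X₁ (i + 1))) (h₂ : Subsingleton (Ext.{w} X S.X₂ i)) :
    Subsingleton (Ext.{w} X S.X₃ i) := by
  refine subsingleton_of_forall_eq 0 fun x => ?_
  obtain ⟨y, rfl⟩ := Ext.covariant_sequence_exact₃ X hS x rfl (Subsingleton.elim _ _)
  rw [Subsingleton.elim y 0, Ext.zero_comp]

lemma subsingleton_ext_X₁_right (hS : S.ShortExact) {X : A} {i : ℕ}
    (h₂ : Subsingleton (Ext.{w} X S.X₂ (i + 1))) (h₃ : Subsingleton (Ext.{w} X S.X₃ i)) :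
    Subsingleton (Ext.{w} X S.X₁ (i + 1)) := by
  refine subsingleton_of_forall_eq 0 fun x => ?_
  obtain ⟨y, rfl⟩ := Ext.covariant_sequence_exact₁ X hS x (Subsingleton.elim _ _) rfl
  rw [Subsingleton.elim y 0, Ext.zero_comp]

lemma exists_extension_of_ext (hS : S.ShortExact) {Y : A} (h : Subsingleton (Ext.{w} S.X₃ Y 1))
    (a : S.X₁ ⟶ Y) : ∃ b : S.X₂ ⟶ Y, S.f ≫ b = a := by
  obtain ⟨x, hx⟩ := Ext.contravariant_sequence_exact₁ hS Y (Ext.mk₀ a) (add_zero 1)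
    (Subsingleton.elim _ _)
  obtain ⟨b, rfl⟩ := (Ext.mk₀_bijective _ _).2 x
  rw [Ext.mk₀_comp_mk₀] at hx
  exact ⟨b, (Ext.mk₀_bijective _ _).1 hx⟩

lemma exists_lift_of_ext (hS : S.ShortExact) {X : A} (h : Subsingleton (Ext.{w} X S.X₁ 1))
    (a : X ⟶ S.X₃) : ∃ b : X ⟶ S.X₂, b ≫ S.g = a := by
  obtain ⟨x, hx⟩ := Ext.covariant_sequence_exact₃ X hS (Ext.mk₀ a) (zero_add 1)
    (Subsingleton.elim _ _)
  obtain ⟨b, rfl⟩ := (Ext.mk₀_bijective _ _).2 x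
  rw [Ext.mk₀_comp_mk₀] at hx
  exact ⟨b, (Ext.mk₀_bijective _ _).1 hx⟩

/-- If every morphism from `S.X₁` to `Y` extends along `S.f`, then the vanishing of
`Ext¹(S.X₂, Y)` implies that of `Ext¹(S.X₃, Y)`. -/
lemma subsingleton_ext_one_of_extension (hS : S.ShortExact) {Y : A}
    (h : ∀ a : S.X₁ ⟶ Y, ∃ b : S.X₂ ⟶ Y, S.f ≫ b = a)
    (h₂ : Subsingleton (Ext.{w} S.X₂ Y 1)) : Subsingleton (Ext.{w} S.X₃ Y 1) := by
  refine subsingleton_of_forall_eq 0 fun x => ?_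
  obtain ⟨y, rfl⟩ := Ext.contravariant_sequence_exact₃ hS Y x (Subsingleton.elim _ _) (add_zero 1)
  obtain ⟨a, rfl⟩ := (Ext.mk₀_bijective _ _).2 y
  obtain ⟨b, rfl⟩ := h a
  rw [← Ext.mk₀_comp_mk₀, hS.extClass_comp_assoc]

/-- The identity of `X` acts on Ext as a sum of maps factoring through `Ext(T, Y)`. -/
lemma subsingleton_ext_of_inAdd_left [HasFiniteBiproducts A] {T X Y : A} (hX : InAdd T X) {i : ℕ}
    (h : Subsingleton (Ext.{w} T Y i)) : Subsingleton (Ext.{w} X Y i) := by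
  obtain ⟨n, f, p, hfp⟩ := inAdd_iff_exists_sum.1 hX
  refine subsingleton_of_forall_eq 0 fun x => ?_
  let φ : (X ⟶ X) →+ Ext.{w} X Y i :=
    AddMonoidHom.mk' (fun a => (Ext.mk₀ a).comp x (zero_add i)) fun a b => by
      rw [Ext.mk₀_add, Ext.add_comp]
  have h₁ : φ (𝟙 X) = x := Ext.mk₀_id_comp x
  rw [← h₁, ← hfp, map_sum]
  refine Finset.sum_eq_zero fun k _ => ?_
  change (Ext.mk₀ (f k ≫ p k)).comp x (zero_add i) = 0
  rw [← Ext.mk₀_comp_mk₀_assoc, Subsingleton.elim ((Ext.mk₀ (p k)).comp x (zero_add i)) 0,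
    Ext.comp_zero]

lemma subsingleton_ext_of_inAdd_right [HasFiniteBiproducts A] {T X Y : A} (hY : InAdd T Y) {i : ℕ}
    (h : Subsingleton (Ext.{w} X T i)) : Subsingleton (Ext.{w} X Y i) := by
  obtain ⟨n, f, p, hfp⟩ := inAdd_iff_exists_sum.1 hY
  refine subsingleton_of_forall_eq 0 fun x => ?_
  let φ : (Y ⟶ Y) →+ Ext.{w} X Y i :=
    AddMonoidHom.mk' (fun a => x.comp (Ext.mk₀ a) (add_zero i)) fun a b => by
      rw [Ext.mk₀_add, Ext.comp_add]
  have h₁ : φ (𝟙 Y) = x := Ext.comp_mk₀_id x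
  rw [← h₁, ← hfp, map_sum]
  refine Finset.sum_eq_zero fun k _ => ?_
  change x.comp (Ext.mk₀ (f k ≫ p k)) (add_zero i) = 0
  rw [← Ext.mk₀_comp_mk₀, ← Ext.comp_assoc_of_third_deg_zero,
    Subsingleton.elim (x.comp (Ext.mk₀ (f k)) (add_zero i)) 0, Ext.zero_comp]

end Ext

/-! ### Perpendicular classes, and `𝒳_T` and `𝒴_T` as coinductive classes -/

section Perpendicular

variable {Λ : Type u} [Ring Λ]

lemma module_finite_of_retract {X Y : ModuleCat.{u} Λ} (r : Retract X Y) (h : Module.Finite Λ Y) :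
    Module.Finite Λ X :=
  Module.Finite.of_surjective r.r.hom ((ModuleCat.epi_iff_surjective _).1 inferInstance)

lemma module_finite_X₂ {S : ShortComplex (ModuleCat.{u} Λ)} (hS : S.ShortExact)
    (h₁ : Module.Finite Λ S.X₁) (h₃ : Module.Finite Λ S.X₃) : Module.Finite Λ S.X₂ :=
  Module.Finite.of_exact ((ShortComplex.ShortExact.moduleCat_exact_iff_function_exact S).1 hS.exact)
    ((ModuleCat.epi_iff_surjective _).1 hS.epi_g)

lemma module_finite_X₁ [IsNoetherianRing Λ] {S : ShortComplex (ModuleCat.{u} Λ)}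
    (hS : S.ShortExact) (h₂ : Module.Finite Λ S.X₂) : Module.Finite Λ S.X₁ :=
  Module.Finite.of_injective S.f.hom ((ModuleCat.mono_iff_injective _).1 hS.mono_f)

lemma module_finite_X₃ {S : ShortComplex (ModuleCat.{u} Λ)} (hS : S.ShortExact)
    (h₂ : Module.Finite Λ S.X₂) : Module.Finite Λ S.X₃ :=
  Module.Finite.of_surjective S.g.hom ((ModuleCat.epi_iff_surjective _).1 hS.epi_g)

lemma module_finite_of_inAdd {T X : ModuleCat.{u} Λ} (hX : InAdd T X) (hT : Module.Finite Λ T) :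
    Module.Finite Λ X := by
  obtain ⟨n, i, p, hip⟩ := inAdd_iff_exists_sum.1 hX
  refine Module.Finite.of_surjective (∑ k, (p k).hom ∘ₗ LinearMap.proj k : (Fin n → T) →ₗ[Λ] X)
    fun x => ⟨fun k => (i k).hom x, ?_⟩
  simpa using congr_arg (fun t => t.hom x) hip

lemma LeftPerp.of_retract {T X Y : ModuleCat.{u} Λ} (hY : LeftPerp T Y) (r : Retract X Y) :
    LeftPerp T X :=
  ⟨module_finite_of_retract r hY.1, fun i hi =>
    subsingleton_ext_of_inAdd_left ((InAdd.refl Y).of_retract r) (hY.2 i hi)⟩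

lemma RightPerp.of_retract {T X Y : ModuleCat.{u} Λ} (hY : RightPerp T Y) (r : Retract X Y) :
    RightPerp T X :=
  ⟨module_finite_of_retract r hY.1, fun i hi =>
    subsingleton_ext_of_inAdd_right ((InAdd.refl Y).of_retract r) (hY.2 i hi)⟩

/-- The Noetherian hypothesis keeps kernels finitely generated; the dual statement only meets
quotients. -/
lemma IsSelfOrthogonal.isCogeneratingPair [IsNoetherianRing Λ] {T : ModuleCat.{u} Λ}
    (hT : IsSelfOrthogonal T) : IsCogeneratingPair (LeftPerp T) (InAdd T) where
  le X hX := ⟨module_finite_of_inAdd hX hT.1, fun i hi =>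
    subsingleton_ext_of_inAdd_left hX (hT.2 i hi)⟩
  of_isZero _ hZ := InAdd.of_isZero hZ
  of_splitting _ s h₁ h₃ := InAdd.of_splitting s h₁ h₃
  prop_X₂ _ hS h₁ h₃ := ⟨module_finite_X₂ hS h₁.1 h₃.1, fun i hi =>
    subsingleton_ext_X₂_left hS (h₁.2 i hi) (h₃.2 i hi)⟩
  prop_X₁ _ hS h₂ h₃ := ⟨module_finite_X₁ hS h₂.1, fun i hi =>
    subsingleton_ext_X₁_left hS (h₂.2 i hi) (h₃.2 (i + 1) (by omega))⟩
  of_retract _ _ r hY := hY.of_retract r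
  exists_extension _ hS h₃ _ hV a := exists_extension_of_ext hS
    (subsingleton_ext_of_inAdd_right hV (h₃.2 1 one_pos)) a

lemma IsSelfOrthogonal.isGeneratingPair {T : ModuleCat.{u} Λ}
    (hT : IsSelfOrthogonal T) : IsGeneratingPair (RightPerp T) (InAdd T) where
  le X hX := ⟨module_finite_of_inAdd hX hT.1, fun i hi =>
    subsingleton_ext_of_inAdd_right hX (hT.2 i hi)⟩
  of_isZero _ hZ := InAdd.of_isZero hZ
  of_splitting _ s h₁ h₃ := InAdd.of_splitting s h₁ h₃
  prop_X₂ _ hS h₁ h₃ := ⟨module_finite_X₂ hS h₁.1 h₃.1, fun i hi =>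
    subsingleton_ext_X₂_right hS (h₁.2 i hi) (h₃.2 i hi)⟩
  prop_X₃ _ hS h₁ h₂ := ⟨module_finite_X₃ hS h₂.1, fun i hi =>
    subsingleton_ext_X₃_right hS (h₁.2 (i + 1) (by omega)) (h₂.2 i hi)⟩
  of_retract _ _ r hY := hY.of_retract r
  exists_lift _ hS h₁ _ hV a := exists_lift_of_ext hS
    (subsingleton_ext_of_inAdd_left hV (h₁.2 1 one_pos)) a

lemma shortExact_of_function_exact {X Y Z : ModuleCat.{u} Λ} (f : X ⟶ Y) (g : Y ⟶ Z)
    (hf : Function.Injective f.hom) (h : Function.Exact f.hom g.hom)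
    (hg : Function.Surjective g.hom) : ∃ w, (ShortComplex.mk f g w).ShortExact := by
  have w : f ≫ g = 0 := by
    ext x
    exact (h _).2 ⟨x, rfl⟩
  exact ⟨w, .mk' ((ShortComplex.ShortExact.moduleCat_exact_iff_function_exact (.mk f g w)).2 h)
    ((ModuleCat.mono_iff_injective _).2 hf) ((ModuleCat.epi_iff_surjective _).2 hg)⟩

/-- The short exact sequence `0 → X → Y → range g → 0` attached to an injective map `f : X → Y` and
a map `g` such that `f`, `g` are exact. -/
lemma shortExact_range {X Y Z : ModuleCat.{u} Λ} (f : X ⟶ Y) (g : Y ⟶ Z)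
    (hf : Function.Injective f.hom) (h : Function.Exact f.hom g.hom) :
    ∃ w, (ShortComplex.mk f (ModuleCat.ofHom g.hom.rangeRestrict) w).ShortExact :=
  shortExact_of_function_exact _ _ hf
    (fun y => (show _ ↔ g.hom y = 0 by rw [Subtype.ext_iff]; rfl).trans (h y))
    g.hom.surjective_rangeRestrict

/-- The short exact sequence `0 → range f → Y → Z → 0` attached to a surjective map `g : Y → Z` and
a map `f` such that `f`, `g` are exact. -/
lemma shortExact_range_subtype {X Y Z : ModuleCat.{u} Λ} (f : X ⟶ Y) (g : Y ⟶ Z)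
    (hg : Function.Surjective g.hom) (h : Function.Exact f.hom g.hom) :
    ∃ w, (ShortComplex.mk (X₂ := Y)
      (ModuleCat.ofHom (LinearMap.range f.hom).subtype) g w).ShortExact :=
  shortExact_of_function_exact _ _ Subtype.val_injective
    (fun y => (h y).trans ⟨fun hy => ⟨⟨y, hy⟩, rfl⟩, by rintro ⟨⟨y, hy⟩, rfl⟩; exact hy⟩) hg

lemma exact_subtype_rangeRestrict {X Y Z : ModuleCat.{u} Λ} (f : X ⟶ Y) (g : Y ⟶ Z)
    (h : Function.Exact f.hom g.hom) :
    Function.Exact (LinearMap.range f.hom).subtype g.hom := fun y =>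
  (h y).trans ⟨fun hy => ⟨⟨y, hy⟩, rfl⟩, by rintro ⟨⟨y, hy⟩, rfl⟩; exact hy⟩

/-- The witnessing class consists of `X` and the images of the differentials. -/
lemma ClassX.cogenerated {T X : ModuleCat.{u} Λ} (h : ClassX T X) :
    Cogenerated (LeftPerp T) (InAdd T) X := by
  obtain ⟨hX, c, hc, hr⟩ := h
  refine ⟨fun Y => LeftPerp T Y ∧
    (Y = X ∨ ∃ i, Y = ModuleCat.of Λ (LinearMap.range (c.d i).hom)), ⟨hX, .inl rfl⟩,
    fun Y hY => hY.1, ?_⟩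
  rintro Y ⟨-, rfl | ⟨i, rfl⟩⟩
  · obtain ⟨w, hw⟩ := shortExact_range c.ι (c.d 0) c.injective c.exact_zero
    exact ⟨_, _, _, _, w, hw, hc 0, hr 0, .inr ⟨0, rfl⟩⟩
  · obtain ⟨w, hw⟩ := shortExact_range
      (ModuleCat.ofHom (LinearMap.range (c.d i).hom).subtype) (c.d (i + 1)) Subtype.val_injective
      (exact_subtype_rangeRestrict _ _ (c.exact_succ i))
    exact ⟨_, _, _, _, w, hw, hc (i + 1), hr (i + 1), .inr ⟨i + 1, rfl⟩⟩

lemma ClassY.generated {T Y : ModuleCat.{u} Λ} (h : ClassY T Y) :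
    Generated (RightPerp T) (InAdd T) Y := by
  obtain ⟨hY, c, hc, hr⟩ := h
  refine ⟨fun Z => RightPerp T Z ∧
    (Z = Y ∨ ∃ i, Z = ModuleCat.of Λ (LinearMap.range (c.d i).hom)), ⟨hY, .inl rfl⟩,
    fun Y hY => hY.1, ?_⟩
  rintro Z ⟨-, rfl | ⟨i, rfl⟩⟩
  · obtain ⟨w, hw⟩ := shortExact_range_subtype (c.d 0) c.π c.surjective c.exact_zero
    exact ⟨_, _, _, _, w, hw, hc 0, hr 0, .inr ⟨0, rfl⟩⟩
  · obtain ⟨w, hw⟩ := shortExact_range_subtype (c.d (i + 1))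
      (ModuleCat.ofHom (c.d i).hom.rangeRestrict) (c.d i).hom.surjective_rangeRestrict
      (fun y => (show _ ↔ (c.d i).hom y = 0 by rw [Subtype.ext_iff]; rfl).trans
        (c.exact_succ i y))
    exact ⟨_, _, _, _, w, hw, hc (i + 1), hr (i + 1), .inr ⟨i + 1, rfl⟩⟩

end Perpendicular

-- The finite sum expressing the identity of `X` is factored through an object of `Q` built up one
-- copy of `T` at a time, so only closure under split extensions and retracts is needed.
open ZeroObject in
lemma InAdd.induction {A : Type*} [Category* A] [Abelian A] [HasFiniteBiproducts A]
    {Q : A → Prop} {T X : A} (hX : InAdd T X) (hzero : Q 0)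
    (hsplit : ∀ {S : ShortComplex A} (_ : S.Splitting), Q S.X₁ → Q S.X₃ → Q S.X₂)
    (hretract : ∀ (X Y : A) (_ : Retract X Y), Q Y → Q X) (hT : Q T) : Q X := by
  obtain ⟨n, i, p, hip⟩ := inAdd_iff_exists_sum.1 hX
  have key : ∀ (n : ℕ) (i : Fin n → (X ⟶ T)) (p : Fin n → (T ⟶ X)),
      ∃ (Z : A) (a : X ⟶ Z) (b : Z ⟶ X), Q Z ∧ a ≫ b = ∑ k, i k ≫ p k := by
    intro n
    induction n with
    | zero => exact fun _ _ => ⟨0, 0, 0, hzero, by simp⟩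
    | succ n ih =>
      intro i p
      obtain ⟨Z, a, b, hZ, hab⟩ := ih (fun k => i k.castSucc) (fun k => p k.castSucc)
      refine ⟨Z ⊞ T, biprod.lift a (i (Fin.last n)), biprod.desc b (p (Fin.last n)),
        hsplit (ShortComplex.Splitting.ofHasBinaryBiproduct Z T) hZ hT, ?_⟩
      rw [biprod.lift_desc, hab, Fin.sum_univ_castSucc]
  obtain ⟨Z, a, b, hZ, hab⟩ := key n i p
  exact hretract X Z ⟨a, b, hab.trans hip⟩ hZ

/-! ### Finiteness of Hom over the base ring -/

section Linear

variable (R : Type u) [CommRing R] {Λ : Type u} [Ring Λ] [Algebra R Λ]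

/-- A module over an `R`-algebra, as an `R`-module. -/
abbrev moduleOfAlgebra (M : ModuleCat.{u} Λ) : Module R M := Module.restrictScalars R Λ M

variable (Λ) in
/-- The `R`-linear structure on the category of modules over an `R`-algebra. -/
abbrev moduleCatLinear : Linear R (ModuleCat.{u} Λ) :=
  letI (M : ModuleCat.{u} Λ) : Module R M := moduleOfAlgebra R M
  haveI (M : ModuleCat.{u} Λ) : IsScalarTower R Λ M := IsScalarTower.restrictScalars R Λ M
  { homModule := fun _ _ => inferInstance }

/-- Evaluation at finitely many generators of `X` embeds `Hom(X, Y)` in a finite power of `Y`, which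
is Noetherian over `R`. -/
lemma module_finite_hom [IsNoetherianRing R] [Module.Finite R Λ] (X Y : ModuleCat.{u} Λ)
    (hX : Module.Finite Λ X) (hY : Module.Finite Λ Y) :
    @Module.Finite R (X ⟶ Y) _ _ ((moduleCatLinear R Λ).homModule X Y) := by
  let (M : ModuleCat.{u} Λ) : Module R M := moduleOfAlgebra R M
  have (M : ModuleCat.{u} Λ) : IsScalarTower R Λ M := IsScalarTower.restrictScalars R Λ M
  have : Module.Finite R Y := Module.Finite.trans Λ Y
  obtain ⟨n, s, hs⟩ := Module.Finite.exists_fin (R := Λ) (M := X)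
  let φ : (X ⟶ Y) →ₗ[R] (Fin n → Y) :=
    { toFun := fun f k => f.hom (s k)
      map_add' := fun _ _ => rfl
      map_smul' := fun _ _ => rfl }
  refine Module.Finite.of_injective φ fun f g hfg => ?_
  ext1
  exact LinearMap.ext_on_range hs fun k => congr_fun hfg k

end Linear

/-! ### The exact category `𝒳_U ∩ 𝒴_T` -/

section Interval

variable {Λ : Type u} [Ring Λ]

/-- The modules with a coresolution by `add U` and a resolution by `add T` of the kinds that define
`𝒳_U` and `𝒴_T`. -/
def intervalProperty (T U : ModuleCat.{u} Λ) : ObjectProperty (ModuleCat.{u} Λ) :=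
  Cogenerated (LeftPerp U) (InAdd U) ⊓ Generated (RightPerp T) (InAdd T)

/-- `X` has a coresolution of length `n` by objects of `add U`. -/
def HasFiniteCoresolution (U : ModuleCat.{u} Λ) : ℕ → ModuleCat.{u} Λ → Prop
  | 0, X => InAdd U X
  | n + 1, X => ∃ (V Z : ModuleCat.{u} Λ) (f : X ⟶ V) (g : V ⟶ Z) (h : f ≫ g = 0),
      (ShortComplex.mk f g h).ShortExact ∧ InAdd U V ∧ HasFiniteCoresolution U n Z

variable {T U : ModuleCat.{u} Λ}

lemma intervalProperty_isClosedUnderExtensions [IsNoetherianRing Λ] (hT : IsSelfOrthogonal T)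
    (hU : IsSelfOrthogonal U) : (intervalProperty T U).IsClosedUnderExtensions where
  prop_X₂_of_shortExact hS h₁ h₃ :=
    ⟨hU.isCogeneratingPair.cogenerated_X₂ hS h₁.1 h₃.1,
      hT.isGeneratingPair.generated_X₂ hS h₁.2 h₃.2⟩

lemma intervalProperty_isStableUnderRetracts [IsNoetherianRing Λ] (hT : IsSelfOrthogonal T)
    (hU : IsSelfOrthogonal U) : (intervalProperty T U).IsStableUnderRetracts where
  of_retract r hY :=
    ⟨hU.isCogeneratingPair.cogenerated_of_retract hY.1 r,
      hT.isGeneratingPair.generated_of_retract hY.2 r⟩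

lemma intervalProperty_containsZero [IsNoetherianRing Λ] (hT : IsSelfOrthogonal T)
    (hU : IsSelfOrthogonal U) : (intervalProperty T U).ContainsZero where
  exists_zero := ⟨_, isZero_zero _,
    hU.isCogeneratingPair.le_cogenerated _ (InAdd.of_isZero (isZero_zero _)),
    hT.isGeneratingPair.le_generated _ (InAdd.of_isZero (isZero_zero _))⟩

section

variable [(intervalProperty T U).IsClosedUnderExtensions]
  [(intervalProperty T U).IsStableUnderRetracts] [(intervalProperty T U).ContainsZero]

/-- The exact structure on the modules in `intervalProperty T U`. -/
noncomputable abbrev intervalExactStructure (T U : ModuleCat.{u} Λ)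
    [(intervalProperty T U).IsClosedUnderExtensions]
    [(intervalProperty T U).IsStableUnderRetracts] [(intervalProperty T U).ContainsZero] :
    ExactStructure (intervalProperty T U).FullSubcategory :=
  extensionClosedExactStructure (intervalProperty T U)

lemma interval_isProjective_of_ext {X : (intervalProperty T U).FullSubcategory}
    (h : ∀ Y, RightPerp T Y → Subsingleton (Abelian.Ext X.obj Y 1)) :
    (intervalExactStructure T U).IsProjective X := by
  intro S hS a
  obtain ⟨b, hb⟩ := exists_lift_of_ext hS
    (h _ (Generated.le _ _ _ S.X₁.property.2)) a.hom
  exact ⟨ObjectProperty.homMk b, by ext1; exact hb⟩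

lemma interval_isInjective_of_ext {X : (intervalProperty T U).FullSubcategory}
    (h : ∀ Y, LeftPerp U Y → Subsingleton (Abelian.Ext Y X.obj 1)) :
    (intervalExactStructure T U).IsInjective X := by
  intro S hS a
  obtain ⟨b, hb⟩ := exists_extension_of_ext hS
    (h _ (Cogenerated.le _ _ _ S.X₃.property.1)) a.hom
  exact ⟨ObjectProperty.homMk b, by ext1; exact hb⟩

/-- The cover provided by `𝒴_T` stays in the category: `T ∈ 𝒳_U` puts `add T` in `𝒳_U`, and `𝒳_U` is
closed under kernels of epimorphisms. -/
lemma interval_exists_cover [IsNoetherianRing Λ] (hT : IsSelfOrthogonal T)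
    (hU : IsSelfOrthogonal U) (hTU : Cogenerated (LeftPerp U) (InAdd U) T)
    (X : (intervalProperty T U).FullSubcategory) :
    ∃ (K Q : (intervalProperty T U).FullSubcategory) (f : K ⟶ Q) (g : Q ⟶ X) (h : f ≫ g = 0),
      (intervalExactStructure T U).conflation (.mk f g h) ∧ InAdd T Q.obj := by
  obtain ⟨Z, V, f, g, w, hV, hTV, hZ⟩ := X.property.2.covered
  have hU' := hU.isCogeneratingPair
  have hVc : Cogenerated (LeftPerp U) (InAdd U) V := hTV.induction
    (hU'.le_cogenerated _ (hU'.of_isZero _ (isZero_zero _)))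
    (fun s h₁ h₃ => hU'.cogenerated_X₂ s.shortExact h₁ h₃)
    (fun _ _ r h => hU'.cogenerated_of_retract h r) hTU
  exact ⟨⟨Z, hU'.cogenerated_X₁ hV hVc X.property.1, hZ⟩,
    ⟨V, hVc, hT.isGeneratingPair.le_generated _ hTV⟩, ObjectProperty.homMk f,
    ObjectProperty.homMk g, by ext1; exact w, hV, hTV⟩

lemma interval_exists_embedding [IsNoetherianRing Λ] (hT : IsSelfOrthogonal T)
    (hU : IsSelfOrthogonal U) (hUT : Generated (RightPerp T) (InAdd T) U)
    (X : (intervalProperty T U).FullSubcategory) :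
    ∃ (J K : (intervalProperty T U).FullSubcategory) (f : X ⟶ J) (g : J ⟶ K) (h : f ≫ g = 0),
      (intervalExactStructure T U).conflation (.mk f g h) ∧ InAdd U J.obj := by
  obtain ⟨V, Z, f, g, w, hV, hUV, hZ⟩ := X.property.1.embeds
  have hT' := hT.isGeneratingPair
  have hVg : Generated (RightPerp T) (InAdd T) V := hUV.induction
    (hT'.le_generated _ (hT'.of_isZero _ (isZero_zero _)))
    (fun s h₁ h₃ => hT'.generated_X₂ s.shortExact h₁ h₃)
    (fun _ _ r h => hT'.generated_of_retract h r) hUT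
  exact ⟨⟨V, hU.isCogeneratingPair.le_cogenerated _ hUV, hVg⟩,
    ⟨Z, hZ, hT'.generated_X₃ hV X.property.2 hVg⟩, ObjectProperty.homMk f,
    ObjectProperty.homMk g, by ext1; exact w, hV, hUV⟩

lemma interval_isProjective_of_inAdd {X : (intervalProperty T U).FullSubcategory}
    (h : InAdd T X.obj) : (intervalExactStructure T U).IsProjective X :=
  interval_isProjective_of_ext fun _ hY => subsingleton_ext_of_inAdd_left h (hY.2 1 one_pos)

lemma interval_isInjective_of_inAdd {X : (intervalProperty T U).FullSubcategory}
    (h : InAdd U X.obj) : (intervalExactStructure T U).IsInjective X :=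
  interval_isInjective_of_ext fun _ hY => subsingleton_ext_of_inAdd_right h (hY.2 1 one_pos)

/-- Conversely to `add T` being projective, a projective object splits off its cover by `add T`. -/
lemma interval_isProgenerator [IsNoetherianRing Λ] (hT : IsSelfOrthogonal T)
    (hU : IsSelfOrthogonal U) (hTU : Cogenerated (LeftPerp U) (InAdd U) T) :
    (intervalExactStructure T U).IsProgenerator
      ⟨T, hTU, hT.isGeneratingPair.le_generated _ (InAdd.refl T)⟩ := by
  refine ⟨fun X => ?_, fun X => ⟨fun h => interval_isProjective_of_inAdd (h.map (ObjectProperty.ι _)),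
    fun h => ?_⟩⟩
  · obtain ⟨K, Q, f, g, w, hc, hQ⟩ := interval_exists_cover hT hU hTU X
    exact ⟨K, Q, f, g, w, hc, interval_isProjective_of_inAdd hQ⟩
  · obtain ⟨K, Q, f, g, w, hc, hQ⟩ := interval_exists_cover hT hU hTU X
    obtain ⟨b, hb⟩ := h _ hc (𝟙 X)
    exact InAdd.of_map (ObjectProperty.ι _) (hQ.of_retract
      ((⟨b, g, hb⟩ : Retract X Q).map (ObjectProperty.ι _)))

lemma interval_isInjectiveCogenerator [IsNoetherianRing Λ] (hT : IsSelfOrthogonal T)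
    (hU : IsSelfOrthogonal U) (hUT : Generated (RightPerp T) (InAdd T) U) :
    (intervalExactStructure T U).IsInjectiveCogenerator
      ⟨U, hU.isCogeneratingPair.le_cogenerated _ (InAdd.refl U), hUT⟩ := by
  refine ⟨fun X => ?_, fun X => ⟨fun h => interval_isInjective_of_inAdd (h.map (ObjectProperty.ι _)),
    fun h => ?_⟩⟩
  · obtain ⟨J, K, f, g, w, hc, hJ⟩ := interval_exists_embedding hT hU hUT X
    exact ⟨J, K, f, g, w, hc, interval_isInjective_of_inAdd hJ⟩
  · obtain ⟨J, K, f, g, w, hc, hJ⟩ := interval_exists_embedding hT hU hUT X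
    obtain ⟨b, hb⟩ := h _ hc (𝟙 X)
    exact InAdd.of_map (ObjectProperty.ι _) (hJ.of_retract
      ((⟨f, b, hb⟩ : Retract X J).map (ObjectProperty.ι _)))

/-- Objects of `add T` have no higher Ext into `T^⊥`, so passing to the kernel of a cover lowers the
vanishing bound by one. At bound `0`, vanishing of `Ext¹` into `T^⊥` gives the lifting property. -/
lemma interval_projDimLE [IsNoetherianRing Λ] (hT : IsSelfOrthogonal T)
    (hU : IsSelfOrthogonal U) (hTU : Cogenerated (LeftPerp U) (InAdd U) T) (n : ℕ)
    (X : (intervalProperty T U).FullSubcategory)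
    (h : ∀ Y, RightPerp T Y → ∀ i, n < i → Subsingleton (Abelian.Ext X.obj Y i)) :
    (intervalExactStructure T U).ProjDimLE n X := by
  induction n generalizing X with
  | zero => exact interval_isProjective_of_ext fun Y hY => h Y hY 1 one_pos
  | succ n ih =>
    obtain ⟨K, Q, f, g, w, hc, hQ⟩ := interval_exists_cover hT hU hTU X
    exact ⟨K, Q, f, g, w, hc, interval_isProjective_of_inAdd hQ, ih K fun Y hY i hi =>
      subsingleton_ext_X₁_left hc (subsingleton_ext_of_inAdd_left hQ (hY.2 i (by omega)))
        (h Y hY (i + 1) (by omega))⟩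

lemma hasFiniteCoresolution_of_injDimLE [IsNoetherianRing Λ] (hT : IsSelfOrthogonal T)
    (hU : IsSelfOrthogonal U) (hUT : Generated (RightPerp T) (InAdd T) U) {n : ℕ}
    {X : (intervalProperty T U).FullSubcategory}
    (h : (intervalExactStructure T U).InjDimLE n X) : HasFiniteCoresolution U n X.obj := by
  have key : ∀ X, (intervalExactStructure T U).IsInjective X → InAdd U X.obj := fun X hX =>
    (((interval_isInjectiveCogenerator hT hU hUT).2 X).2 hX).map (ObjectProperty.ι _)
  induction n generalizing X with
  | zero => exact key X h
  | succ n ih =>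
    obtain ⟨J, K, f, g, w, hc, hJ, hK⟩ := h
    exact ⟨J.obj, K.obj, f.hom, g.hom, congr_arg (·.hom) w, hc, key J hJ, ih hK⟩

end

/-- Gorenstein symmetry for exact categories, applied to `𝒳_U ∩ 𝒴_T`. -/
lemma ExactGorensteinSymmetry.exists_hasFiniteCoresolution {R : Type u} [CommRing R]
    [IsArtinianRing R] (hR : ExactGorensteinSymmetry R) [Algebra R Λ] [Module.Finite R Λ]
    (hT : IsSelfOrthogonal T) (hU : IsSelfOrthogonal U)
    (hTU : Cogenerated (LeftPerp U) (InAdd U) T) (hUT : Generated (RightPerp T) (InAdd T) U)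
    (hpd : FinitePD U) : ∃ n, HasFiniteCoresolution U n T := by
  have : IsNoetherianRing Λ := IsNoetherianRing.of_finite R Λ
  have := intervalProperty_isClosedUnderExtensions hT hU
  have := intervalProperty_isStableUnderRetracts hT hU
  have := intervalProperty_containsZero hT hU
  have := isIdempotentComplete_fullSubcategory (intervalProperty T U)
    fun X Y r h => (intervalProperty T U).prop_of_retract r h
  let := moduleCatLinear R Λ
  have hfin : IsHomFinite R (intervalProperty T U).FullSubcategory := fun X Y =>
    have := module_finite_hom R X.obj Y.obj (Cogenerated.le _ _ _ X.property.1).1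
      (Cogenerated.le _ _ _ Y.property.1).1
    Module.Finite.equiv InducedCategory.homLinearEquiv.symm
  obtain ⟨n, hn⟩ := hpd
  -- The progenerator is `T` and the injectives are `add U`, so `hm` is a coresolution of `T` by
  -- `add U`. The bound on `U` holds because `Ext^i(U, -)` vanishes for `i ≥ n + 1`.
  obtain ⟨m, hm⟩ := hR _ (intervalExactStructure T U) hfin
    (isKrullSchmidt_of_isHomFinite _ R hfin) _ _ (interval_isProgenerator hT hU hTU)
    (interval_isInjectiveCogenerator hT hU hUT)
    ⟨n, interval_projDimLE hT hU hTU n _ fun Y _ i hi => HasProjectiveDimensionLT.subsingleton U (n + 1) i hi Y⟩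
  exact ⟨m, hasFiniteCoresolution_of_injDimLE hT hU hUT hm⟩

end Interval

/-! ### Finite coresolutions and tilting modules -/

section Coresolutions

variable {Λ : Type u} [Ring Λ] {T X : ModuleCat.{u} Λ}

/-- The sequence `0 → X → X → 0 → ⋯`. -/
noncomputable def Coresolution.single (X : ModuleCat.{u} Λ) : Coresolution X where
  obj
    | 0 => X
    | _ + 1 => ModuleCat.of Λ PUnit
  ι := 𝟙 X
  d _ := 0
  injective _ _ h := h
  exact_zero y := ⟨fun _ => ⟨y, rfl⟩, fun _ => rfl⟩
  exact_succ _ _ := ⟨fun _ => ⟨0, rfl⟩, fun _ => rfl⟩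

/-- Splicing a short exact sequence `0 → X → V → Z → 0` with a coresolution of `Z`. -/
noncomputable def Coresolution.cons {V Z : ModuleCat.{u} Λ} (f : X ⟶ V) (g : V ⟶ Z)
    (hf : Function.Injective f.hom) (hfg : Function.Exact f.hom g.hom)
    (hg : Function.Surjective g.hom) (c : Coresolution Z) : Coresolution X where
  obj
    | 0 => V
    | i + 1 => c.obj i
  ι := f
  d
    | 0 => g ≫ c.ι
    | i + 1 => c.d i
  injective := hf
  exact_zero y :=
    (show c.ι.hom (g.hom y) = 0 ↔ _ from (map_eq_zero_iff _ c.injective)).trans (hfg y)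
  exact_succ
    | 0 => fun y => (c.exact_zero y).trans
        ⟨fun ⟨z, hz⟩ => let ⟨x, hx⟩ := hg z; ⟨x, (congr_arg _ hx).trans hz⟩,
          fun ⟨x, hx⟩ => ⟨g.hom x, hx⟩⟩
    | i + 1 => c.exact_succ i

/-- The coresolution of the first cosyzygy. -/
noncomputable def Coresolution.tail (c : Coresolution X) :
    Coresolution (ModuleCat.of Λ (LinearMap.range (c.d 0).hom)) where
  obj i := c.obj (i + 1)
  ι := ModuleCat.ofHom (LinearMap.range (c.d 0).hom).subtype
  d i := c.d (i + 1)
  injective := Subtype.val_injective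
  exact_zero := exact_subtype_rangeRestrict _ _ (c.exact_succ 0)
  exact_succ i := c.exact_succ (i + 1)

lemma HasFiniteCoresolution.exists_coresolution {n : ℕ} (h : HasFiniteCoresolution T n X) :
    ∃ c : Coresolution X, (∀ i, i ≤ n → InAdd T (c.obj i)) ∧ ∀ i, n < i → IsZero (c.obj i) := by
  induction n generalizing X with
  | zero =>
    refine ⟨.single X, fun i hi => ?_, fun i hi => ?_⟩
    · obtain rfl : i = 0 := by omega
      exact h
    · obtain ⟨j, rfl⟩ : ∃ j, i = j + 1 := ⟨i - 1, by omega⟩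
      exact ModuleCat.isZero_of_subsingleton (ModuleCat.of Λ PUnit)
  | succ n ih =>
    obtain ⟨V, Z, f, g, w, hs, hV, hZ⟩ := h
    obtain ⟨c, hc, hc'⟩ := ih hZ
    refine ⟨.cons f g ((ModuleCat.mono_iff_injective _).1 hs.mono_f)
      ((ShortComplex.ShortExact.moduleCat_exact_iff_function_exact _).1 hs.exact)
      ((ModuleCat.epi_iff_surjective _).1 hs.epi_g) c, fun i hi => ?_, fun i hi => ?_⟩
    · cases i with
      | zero => exact hV
      | succ i => exact hc i (by omega)
    · cases i with
      | zero => omega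
      | succ i => exact hc' i (by omega)

lemma Coresolution.hasFiniteCoresolution {n : ℕ} (c : Coresolution X)
    (hc : ∀ i, i ≤ n → InAdd T (c.obj i)) (hc' : ∀ i, n < i → IsZero (c.obj i)) :
    HasFiniteCoresolution T n X := by
  induction n generalizing X with
  | zero =>
    have := (ModuleCat.mono_iff_injective _).2 c.injective
    have : Epi c.ι := (ModuleCat.epi_iff_surjective _).2 fun y =>
      (c.exact_zero y).1 (by rw [(hc' 1 one_pos).eq_of_tgt (c.d 0) 0]; rfl)
    have := isIso_of_mono_of_epi c.ι
    exact (hc 0 le_rfl).of_retract (Retract.ofIso (asIso c.ι))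
  | succ n ih =>
    obtain ⟨w, hw⟩ := shortExact_range c.ι (c.d 0) c.injective c.exact_zero
    exact ⟨_, _, _, _, w, hw, hc 0 (by omega), ih c.tail (fun i hi => hc (i + 1) (by omega))
      fun i hi => hc' (i + 1) (by omega)⟩

lemma HasFiniteCoresolution.subsingleton_ext {n : ℕ} (h : HasFiniteCoresolution T n X)
    {M : ModuleCat.{u} Λ} (hM : ∀ i : ℕ, 0 < i → Subsingleton (Abelian.Ext M T i)) {i : ℕ}
    (hi : n < i) : Subsingleton (Abelian.Ext M X i) := by
  induction n generalizing X i with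
  | zero => exact subsingleton_ext_of_inAdd_right h (hM i hi)
  | succ n ih =>
    obtain ⟨V, Z, f, g, w, hs, hV, hZ⟩ := h
    obtain ⟨i, rfl⟩ : ∃ j, i = j + 1 := ⟨i - 1, by omega⟩
    exact subsingleton_ext_X₁_right hs (subsingleton_ext_of_inAdd_right hV (hM _ (by omega)))
      (ih hZ (by omega))

lemma hasProjectiveDimensionLT_of_inAdd {n : ℕ} (hX : InAdd T X)
    (hT : HasProjectiveDimensionLT T n) : HasProjectiveDimensionLT X n :=
  (hasProjectiveDimensionLT_iff X n).2 fun i hi Y e =>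
    have := HasProjectiveDimensionLT.subsingleton T n i hi Y
    (subsingleton_ext_of_inAdd_left hX this).elim e 0

/-- The kernel of an epimorphism between modules of projective dimension at most `m` has projective
dimension at most `m`, so the bound for `T` survives whatever the length of the coresolution. -/
lemma HasFiniteCoresolution.finitePD {n : ℕ} (h : HasFiniteCoresolution T n X)
    (hT : FinitePD T) : FinitePD X := by
  obtain ⟨m, hm⟩ := hT
  refine ⟨m, ?_⟩
  induction n generalizing X with
  | zero => exact hasProjectiveDimensionLT_of_inAdd h hm
  | succ n ih =>
    obtain ⟨V, Z, f, g, w, hs, hV, hZ⟩ := h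
    have : HasProjectiveDimensionLT Z (m + 1) := ih hZ
    exact hs.hasProjectiveDimensionLT_X₁ (m + 1) (hasProjectiveDimensionLT_of_inAdd hV hm)
      (hasProjectiveDimensionLT_of_ge Z (m + 1) (m + 2) (by omega))

/-- Splicing the short exact sequences provided by coinduction into a coresolution. -/
lemma Cogenerated.classX (h : Cogenerated (LeftPerp T) (InAdd T) X) : ClassX T X := by
  let S := {Y : ModuleCat.{u} Λ // Cogenerated (LeftPerp T) (InAdd T) Y}
  choose V Z f g w hs hV hZ using fun Y : S => Y.2.embeds
  -- The successive cosyzygies, obtained by iterating one chosen embedding step.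
  let seq : ℕ → S := Nat.rec ⟨X, h⟩ fun _ Y => ⟨Z Y, hZ Y⟩
  let f' (i : ℕ) : (seq i).1 ⟶ V (seq i) := f (seq i)
  let g' (i : ℕ) : V (seq i) ⟶ (seq (i + 1)).1 := g (seq i)
  have hf (i : ℕ) : Function.Injective (f' i).hom :=
    (ModuleCat.mono_iff_injective _).1 (hs (seq i)).mono_f
  have hg (i : ℕ) : Function.Surjective (g' i).hom :=
    (ModuleCat.epi_iff_surjective _).1 (hs (seq i)).epi_g
  have hfg (i : ℕ) : Function.Exact (f' i).hom (g' i).hom :=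
    (ShortComplex.ShortExact.moduleCat_exact_iff_function_exact _).1 (hs (seq i)).exact
  let c : Coresolution X :=
    { obj := fun i => V (seq i)
      ι := f' 0
      d := fun i => g' i ≫ f' (i + 1)
      injective := hf 0
      exact_zero := fun y =>
        (show (f' 1).hom ((g' 0).hom y) = 0 ↔ _ from map_eq_zero_iff _ (hf 1)).trans (hfg 0 y)
      exact_succ := fun i y =>
        ((show (f' (i + 2)).hom ((g' (i + 1)).hom y) = 0 ↔ _ from
          map_eq_zero_iff _ (hf (i + 2))).trans (hfg (i + 1) y)).trans
          ⟨fun ⟨z, hz⟩ => let ⟨x, hx⟩ := hg i z; ⟨x, (congr_arg _ hx).trans hz⟩,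
            fun ⟨x, hx⟩ => ⟨(g' i).hom x, hx⟩⟩ }
  refine ⟨Cogenerated.le _ _ _ h, c, fun i => hV _, fun i => ?_⟩
  -- As `g' i` is onto, the image of the differential is the embedded cosyzygy `seq (i + 1)`.
  have hr : LinearMap.range (c.d i).hom = LinearMap.range (f' (i + 1)).hom := by
    change LinearMap.range ((f' (i + 1)).hom ∘ₗ (g' i).hom) = _
    exact LinearMap.range_comp_of_range_eq_top _ (LinearMap.range_eq_top.2 (hg i))
  rw [hr]
  exact (Cogenerated.le _ _ _ (seq (i + 1)).2).of_retract
    (Retract.ofIso (LinearEquiv.ofInjective _ (hf (i + 1))).toModuleIso.symm)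

lemma isTilting_iff : IsTilting T ↔ FinitePD T ∧ IsSelfOrthogonal T ∧
    ∃ n, HasFiniteCoresolution T n (ModuleCat.of Λ Λ) := by
  refine and_congr_right fun _ => and_congr_right fun _ => ⟨?_, ?_⟩
  · rintro ⟨n, c, hc, hc'⟩
    exact ⟨n, c.hasFiniteCoresolution hc hc'⟩
  · rintro ⟨n, h⟩
    exact ⟨n, h.exists_coresolution⟩

end Coresolutions

/-! ### The regular module -/

section Regular

variable {Λ : Type u} [Ring Λ]

instance projective_regular : Projective (ModuleCat.of Λ Λ) :=
  (IsProjective.iff_projective _).1 inferInstance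

lemma subsingleton_ext_regular (Y : ModuleCat.{u} Λ) {i : ℕ} (hi : 0 < i) :
    Subsingleton (Abelian.Ext (ModuleCat.of Λ Λ) Y i) :=
  HasProjectiveDimensionLT.subsingleton (ModuleCat.of Λ Λ) 1 i hi Y

lemma isSelfOrthogonal_regular : IsSelfOrthogonal (ModuleCat.of Λ Λ) :=
  ⟨inferInstanceAs (Module.Finite Λ Λ), fun _ hi => subsingleton_ext_regular _ hi⟩

lemma inAdd_regular_fin (n : ℕ) : InAdd (ModuleCat.of Λ Λ) (ModuleCat.of Λ (Fin n → Λ)) := by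
  refine inAdd_iff_exists_sum.2 ⟨n, fun k => ModuleCat.ofHom (LinearMap.proj k),
    fun k => ModuleCat.ofHom (LinearMap.single Λ (fun _ => Λ) k), ?_⟩
  ext x k
  simp

/-- All finitely generated modules form a witnessing class: free covers have finitely generated
kernels, and `Λ^⊥` is no restriction. -/
lemma generated_regular [IsNoetherianRing Λ] {X : ModuleCat.{u} Λ} (hX : Module.Finite Λ X) :
    Generated (RightPerp (ModuleCat.of Λ Λ)) (InAdd (ModuleCat.of Λ Λ)) X := by
  refine ⟨fun Y => Module.Finite Λ Y, hX,
    fun Y hY => ⟨hY, fun i hi => subsingleton_ext_regular Y hi⟩, fun Y hY => ?_⟩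
  obtain ⟨n, g, hg⟩ := Module.Finite.exists_fin' Λ Y
  obtain ⟨w, hw⟩ := shortExact_of_function_exact
    (ModuleCat.ofHom (LinearMap.ker g).subtype) (ModuleCat.ofHom g) Subtype.val_injective
    (LinearMap.exact_subtype_ker_map g) hg
  exact ⟨_, _, _, _, w, hw, inAdd_regular_fin n, inferInstanceAs (Module.Finite Λ (LinearMap.ker g))⟩

end Regular

/-! ### From Gorenstein symmetry to tilting modules -/

theorem ExactGorensteinSymmetry.wakamatsuTiltingConjecture {R : Type u} [CommRing R]
    [IsArtinianRing R] (hR : ExactGorensteinSymmetry R) : WakamatsuTiltingConjecture R := by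
  intro Λ _ _ _ T hT hpd
  have : IsNoetherianRing Λ := IsNoetherianRing.of_finite R Λ
  -- The exact category used is `𝒳_T ∩ 𝒴_Λ = 𝒳_T`, with progenerator `Λ` and injective cogenerator
  -- `T`.
  exact isTilting_iff.2 ⟨hpd, hT.1, hR.exists_hasFiniteCoresolution isSelfOrthogonal_regular hT.1
    hT.2.cogenerated (generated_regular hT.1.1) hpd⟩

theorem ExactGorensteinSymmetry.tiltingUpwardClosed {R : Type u} [CommRing R]
    [IsArtinianRing R] (hR : ExactGorensteinSymmetry R) : TiltingUpwardClosed R := by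
  intro Λ _ _ _ T U hT hU hTU hUT htilt
  -- This coresolution of `T` by `add U` serves only to bound the projective dimension of `T`; the
  -- coresolution of `Λ` by `add T` comes from a second use of Gorenstein symmetry.
  obtain ⟨n, hn⟩ := hR.exists_hasFiniteCoresolution hT.1 hU.1 hTU.cogenerated hUT.generated htilt.1
  exact hR.wakamatsuTiltingConjecture Λ T hT (hn.finitePD htilt.1)

/-! ### Embedding an exact category in modules by `Hom(P, -)` -/

section Coyoneda

variable {E : Type w} [Category.{u} E] [Preadditive E] {P : E}

/-- The functor `Hom(P, -)` with values in modules over the opposite endomorphism ring of `P`. -/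
noncomputable abbrev homFunctor (P : E) : E ⥤ ModuleCat.{u} (End P)ᵐᵒᵖ := preadditiveCoyonedaObj P

/-- The map underlying a morphism of modules `Hom(P, X) → Hom(P, Y)`. -/
noncomputable def homMap {X Y : E} (φ : (homFunctor P).obj X ⟶ (homFunctor P).obj Y) (x : P ⟶ X) : P ⟶ Y :=
  φ.hom x

lemma homMap_map {X Y : E} (f : X ⟶ Y) (x : P ⟶ X) :
    homMap ((homFunctor P).map f) x = x ≫ f := rfl

lemma homMap_comp_left {X Y : E} (φ : (homFunctor P).obj X ⟶ (homFunctor P).obj Y) (a : P ⟶ P)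
    (x : P ⟶ X) : homMap φ (a ≫ x) = a ≫ homMap φ x :=
  φ.hom.map_smul (MulOpposite.op (a : End P)) x

lemma homMap_sum {X Y : E} (φ : (homFunctor P).obj X ⟶ (homFunctor P).obj Y) {n : ℕ}
    (x : Fin n → (P ⟶ X)) : homMap φ (∑ k, x k) = ∑ k, homMap φ (x k) :=
  map_sum φ.hom x Finset.univ

lemma homMap_comp {X Y Z : E} (φ : (homFunctor P).obj X ⟶ (homFunctor P).obj Y)
    (ψ : (homFunctor P).obj Y ⟶ (homFunctor P).obj Z) (x : P ⟶ X) :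
    homMap (φ ≫ ψ) x = homMap ψ (homMap φ x) := rfl

lemma hom_ext_homMap {X Y : E} {φ ψ : (homFunctor P).obj X ⟶ (homFunctor P).obj Y}
    (h : ∀ x, homMap φ x = homMap ψ x) : φ = ψ :=
  ModuleCat.hom_ext (LinearMap.ext h)

/-- `Hom(P, P)` is the regular module. -/
noncomputable def homFunctorObjSelf (P : E) :
    (homFunctor P).obj P ≅ ModuleCat.of (End P)ᵐᵒᵖ (End P)ᵐᵒᵖ :=
  LinearEquiv.toModuleIso
    { toFun := fun x : P ⟶ P => MulOpposite.op (x : End P)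
      invFun := fun x => x.unop
      map_add' := fun _ _ => rfl
      map_smul' := fun _ _ => rfl
      left_inv := fun _ => rfl
      right_inv := fun _ => rfl }

variable [HasFiniteBiproducts E] {𝓔 : ExactStructure E} {I : E}

/-- The functor `Hom(P, -)` is full on morphisms from objects of `add P`. -/
lemma InAdd.exists_homFunctor_map_eq {Q Y : E} (hQ : InAdd P Q)
    (φ : (homFunctor P).obj Q ⟶ (homFunctor P).obj Y) : ∃ q, (homFunctor P).map q = φ := by
  obtain ⟨n, i, p, h⟩ := inAdd_iff_exists_sum.1 hQ
  refine ⟨∑ k, i k ≫ homMap φ (p k), hom_ext_homMap fun x => ?_⟩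
  conv_rhs => rw [← Category.comp_id x, ← h, Preadditive.comp_sum, homMap_sum]
  simp only [homMap_map, Preadditive.comp_sum]
  exact Finset.sum_congr rfl fun k _ => by
    rw [← Category.assoc, ← Category.assoc, homMap_comp_left]

/-- Morphisms from an object of `add P` are determined by their action on `Hom(P, -)`. -/
lemma InAdd.hom_ext {Q Y : E} (hQ : InAdd P Q) {f g : Q ⟶ Y}
    (h : ∀ p : P ⟶ Q, p ≫ f = p ≫ g) : f = g := by
  obtain ⟨n, i, p, hip⟩ := inAdd_iff_exists_sum.1 hQ
  rw [← Category.id_comp f, ← Category.id_comp g, ← hip]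
  simp only [Preadditive.sum_comp, Category.assoc, h]

lemma InAdd.homFunctor_regular {Q : E} (hQ : InAdd P Q) :
    InAdd (ModuleCat.of (End P)ᵐᵒᵖ (End P)ᵐᵒᵖ) ((homFunctor P).obj Q) :=
  (InAdd.of_retract (InAdd.refl _) (Retract.ofIso (homFunctorObjSelf P))).trans
    (hQ.map (homFunctor P))

lemma subsingleton_ext_homFunctor_of_inAdd {Q : E} (hQ : InAdd P Q)
    (M : ModuleCat.{u} (End P)ᵐᵒᵖ) {i : ℕ} (hi : 0 < i) :
    Subsingleton (Abelian.Ext ((homFunctor P).obj Q) M i) :=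
  subsingleton_ext_of_inAdd_left hQ.homFunctor_regular (subsingleton_ext_regular M hi)

lemma ExactStructure.mono_f {S : ShortComplex E} (hS : 𝓔.conflation S) : Mono S.f := by
  obtain ⟨h⟩ := 𝓔.isKernel hS
  exact mono_of_isLimit_fork h

lemma ExactStructure.epi_g {S : ShortComplex E} (hS : 𝓔.conflation S) : Epi S.g := by
  obtain ⟨h⟩ := 𝓔.isCokernel hS
  exact epi_of_isColimit_cofork h

namespace ExactStructure.IsProgenerator

lemma isProjective (hP : 𝓔.IsProgenerator P) : 𝓔.IsProjective P := (hP.2 P).1 (InAdd.refl P)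

lemma exists_cover (hP : 𝓔.IsProgenerator P) (X : E) :
    ∃ (K Q : E) (f : K ⟶ Q) (g : Q ⟶ X) (h : f ≫ g = 0),
      𝓔.conflation (ShortComplex.mk f g h) ∧ InAdd P Q := by
  obtain ⟨K, Q, f, g, h, hc, hQ⟩ := hP.1 X
  exact ⟨K, Q, f, g, h, hc, (hP.2 Q).2 hQ⟩

/-- The functor `Hom(P, -)` is exact. -/
lemma shortExact (hP : 𝓔.IsProgenerator P) {S : ShortComplex E} (hS : 𝓔.conflation S) :
    (S.map (homFunctor P)).ShortExact := by
  obtain ⟨h⟩ := 𝓔.isKernel hS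
  have := 𝓔.mono_f hS
  refine .mk' ((ShortComplex.ShortExact.moduleCat_exact_iff_function_exact _).2 fun y => ⟨?_, ?_⟩)
    ((ModuleCat.mono_iff_injective _).2 fun x y hxy => ?_)
    ((ModuleCat.epi_iff_surjective _).2 fun a => hP.isProjective S hS a)
  · intro hy
    obtain ⟨l, hl⟩ := KernelFork.IsLimit.lift' h y hy
    exact ⟨l, hl⟩
  · rintro ⟨x, rfl⟩
    have hz (x : P ⟶ S.X₁) : (x ≫ S.f) ≫ S.g = 0 := by rw [Category.assoc, S.zero, comp_zero]
    exact hz x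
  · exact (cancel_mono S.f).1 hxy

/-- Faithfulness of `Hom(P, -)`: covers by `add P` are epimorphisms, and on `add P` a map is
determined by its composites with maps from `P`. -/
lemma hom_ext (hP : 𝓔.IsProgenerator P) {X Y : E} {f g : X ⟶ Y}
    (h : ∀ p : P ⟶ X, p ≫ f = p ≫ g) : f = g := by
  obtain ⟨K, Q, k, q, w, hc, hQ⟩ := hP.exists_cover X
  have : Epi q := 𝓔.epi_g hc
  refine (cancel_epi q).1 (hQ.hom_ext fun p => ?_)
  rw [← Category.assoc, ← Category.assoc, h]

/-- The functor `Hom(P, -)` is full. -/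
lemma exists_map_eq (hP : 𝓔.IsProgenerator P) {X Y : E}
    (φ : (homFunctor P).obj X ⟶ (homFunctor P).obj Y) : ∃ f, (homFunctor P).map f = φ := by
  obtain ⟨K, Q, k, q, w, hc, hQ⟩ := hP.exists_cover X
  -- On the cover `Q` the map is realised by some `a`; faithfulness shows that `a` kills `K`, hence
  -- it descends to the cokernel `X`.
  obtain ⟨a, ha⟩ := hQ.exists_homFunctor_map_eq ((homFunctor P).map q ≫ φ)
  obtain ⟨hcok⟩ := 𝓔.isCokernel hc
  have hka : k ≫ a = 0 := hP.hom_ext fun p => by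
    rw [comp_zero, ← Category.assoc, ← homMap_map a, ha, homMap_comp, homMap_map, Category.assoc, w,
      comp_zero]
    exact φ.hom.map_zero
  obtain ⟨f, hf⟩ := CokernelCofork.IsColimit.desc' hcok a hka
  have : Epi ((homFunctor P).map q) := (hP.shortExact hc).epi_g
  refine ⟨f, (cancel_epi ((homFunctor P).map q)).1 ?_⟩
  rw [← ha, ← Functor.map_comp]
  exact congrArg _ hf

lemma exists_extension (hP : 𝓔.IsProgenerator P) {J : E} (hJ : 𝓔.IsInjective J)
    {S : ShortComplex E} (hS : 𝓔.conflation S)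
    (a : (homFunctor P).obj S.X₁ ⟶ (homFunctor P).obj J) :
    ∃ b, (homFunctor P).map S.f ≫ b = a := by
  obtain ⟨a, rfl⟩ := hP.exists_map_eq a
  obtain ⟨b, rfl⟩ := hJ S hS a
  exact ⟨(homFunctor P).map b, ((homFunctor P).map_comp _ _).symm⟩

/-- Covers by `add P` become covers by projective modules. Fullness carries injectivity of `J` into
an extension property that kills `Ext¹`; higher degrees shift down along the cover. -/
lemma subsingleton_ext_of_isInjective (hP : 𝓔.IsProgenerator P) {J : E}
    (hJ : 𝓔.IsInjective J) (i : ℕ) (X : E) :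
    Subsingleton (Abelian.Ext ((homFunctor P).obj X) ((homFunctor P).obj J) (i + 1)) := by
  induction i generalizing X with
  | zero =>
    obtain ⟨K, Q, k, q, w, hc, hQ⟩ := hP.exists_cover X
    exact subsingleton_ext_one_of_extension (hP.shortExact hc) (hP.exists_extension hJ hc)
      (subsingleton_ext_homFunctor_of_inAdd hQ _ one_pos)
  | succ i ih =>
    obtain ⟨K, Q, k, q, w, hc, hQ⟩ := hP.exists_cover X
    exact subsingleton_ext_X₃_left (hP.shortExact hc) (ih K)
      (subsingleton_ext_homFunctor_of_inAdd hQ _ (Nat.succ_pos _))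

lemma module_finite (hP : 𝓔.IsProgenerator P) (X : E) :
    Module.Finite (End P)ᵐᵒᵖ ((homFunctor P).obj X) := by
  obtain ⟨K, Q, k, q, w, hc, hQ⟩ := hP.exists_cover X
  exact module_finite_X₃ (hP.shortExact hc)
    (module_finite_of_inAdd hQ.homFunctor_regular (inferInstanceAs (Module.Finite (End P)ᵐᵒᵖ _)))

lemma leftPerp (hP : 𝓔.IsProgenerator P) (hI : 𝓔.IsInjective I) (X : E) :
    LeftPerp ((homFunctor P).obj I) ((homFunctor P).obj X) :=
  ⟨hP.module_finite X, fun i hi => by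
    obtain ⟨i, rfl⟩ := Nat.exists_eq_succ_of_ne_zero hi.ne'
    exact hP.subsingleton_ext_of_isInjective hI i X⟩

/-- The image of `E` is itself a witnessing class, since each embedding into an injective has its
cokernel in `E`. -/
lemma cogenerated (hP : 𝓔.IsProgenerator P) (hI : 𝓔.IsInjectiveCogenerator I) (X : E) :
    Cogenerated (LeftPerp ((homFunctor P).obj I)) (InAdd ((homFunctor P).obj I))
      ((homFunctor P).obj X) := by
  refine ⟨fun M => ∃ X, (homFunctor P).obj X = M, ⟨X, rfl⟩, ?_, ?_⟩
  · rintro _ ⟨X, rfl⟩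
    exact hP.leftPerp ((hI.2 I).1 (InAdd.refl I)) X
  · rintro _ ⟨X, rfl⟩
    obtain ⟨J, K, f, g, w, hc, hJ⟩ := hI.1 X
    have hS := hP.shortExact hc
    exact ⟨_, _, _, _, _, hS, ((hI.2 J).2 hJ).map (homFunctor P), K, rfl⟩

lemma isWakamatsuTilting [IsNoetherianRing (End P)ᵐᵒᵖ] (hP : 𝓔.IsProgenerator P)
    (hI : 𝓔.IsInjectiveCogenerator I) : IsWakamatsuTilting ((homFunctor P).obj I) := by
  have hT : IsSelfOrthogonal ((homFunctor P).obj I) :=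
    hP.leftPerp ((hI.2 I).1 (InAdd.refl I)) I
  have := hT.isCogeneratingPair.isClosedUnderIsomorphisms_cogenerated
  exact ⟨hT, Cogenerated.classX
    (ObjectProperty.prop_of_iso _ (homFunctorObjSelf P) (hP.cogenerated hI P))⟩

lemma finitePD (hP : 𝓔.IsProgenerator P) {n : ℕ} {X : E} (h : 𝓔.ProjDimLE n X) :
    HasProjectiveDimensionLE ((homFunctor P).obj X) n := by
  have key {Q : E} (hQ : 𝓔.IsProjective Q) (m : ℕ) :
      HasProjectiveDimensionLT ((homFunctor P).obj Q) (m + 1) :=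
    have : HasProjectiveDimensionLT ((homFunctor P).obj Q) 1 :=
      hasProjectiveDimensionLT_of_inAdd ((hP.2 Q).2 hQ).homFunctor_regular inferInstance
    hasProjectiveDimensionLT_of_ge _ 1 _ (by omega)
  induction n generalizing X with
  | zero => exact key h 0
  | succ n ih =>
    obtain ⟨K, Q, f, g, w, hc, hQ, hK⟩ := h
    exact (hP.shortExact hc).hasProjectiveDimensionLT_X₃ (n + 1) (ih hK) (key hQ (n + 1))

/-- Vanishing in the single degree `n + 1` is enough: embedding in an injective shifts it down to
degree `1`, where the extension found among modules comes from `E` because `Hom(P, -)` is full and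
faithful. -/
lemma injDimLE (hP : 𝓔.IsProgenerator P) (hI : 𝓔.IsInjectiveCogenerator I) {n : ℕ} {X : E}
    (h : ∀ Z, Subsingleton
      (Abelian.Ext ((homFunctor P).obj Z) ((homFunctor P).obj X) (n + 1))) :
    𝓔.InjDimLE n X := by
  induction n generalizing X with
  | zero =>
    intro S hS a
    obtain ⟨b, hb⟩ := exists_extension_of_ext (hP.shortExact hS) (h S.X₃) ((homFunctor P).map a)
    obtain ⟨b, rfl⟩ := hP.exists_map_eq b
    refine ⟨b, hP.hom_ext fun p => ?_⟩
    rw [← Category.assoc]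
    exact congrArg (fun φ => homMap φ p) hb
  | succ n ih =>
    obtain ⟨J, K, f, g, w, hc, hJ⟩ := hI.1 X
    exact ⟨J, K, f, g, w, hc, hJ, ih fun Z => subsingleton_ext_X₃_right (hP.shortExact hc) (h Z)
      (hP.subsingleton_ext_of_isInjective hJ n Z)⟩

end ExactStructure.IsProgenerator

end Coyoneda

/-! ### From the tilting conjecture to Gorenstein symmetry -/

theorem WakamatsuTiltingConjecture.exactGorensteinSymmetry {R : Type u} [CommRing R]
    [IsArtinianRing R] (hR : WakamatsuTiltingConjecture R) : ExactGorensteinSymmetry R := by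
  intro E _ _ _ _ 𝓔 hfin _ P I hP hI ⟨m, hm⟩
  have : Module.Finite R (End P) := hfin P P
  have : Module.Finite R (End P)ᵐᵒᵖ :=
    Module.Finite.equiv (MulOpposite.opLinearEquiv R (M := End P))
  have : IsNoetherianRing (End P)ᵐᵒᵖ := IsNoetherianRing.of_finite R _
  -- Only the coresolution, of length `n`, of the regular module by `add Hom(P, I)` is kept. Each
  -- `Hom(P, Z)` is left perpendicular to `Hom(P, I)`, so its Ext into the regular module, which is
  -- `Hom(P, P)`, vanishes beyond degree `n`.
  obtain ⟨-, -, n, hn⟩ := isTilting_iff.1 (hR _ _ (hP.isWakamatsuTilting hI) ⟨m, hP.finitePD hm⟩)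
  refine ⟨n, hP.injDimLE hI fun Z => ?_⟩
  exact subsingleton_ext_of_inAdd_right (InAdd.refl P).homFunctor_regular
    (hn.subsingleton_ext (hP.leftPerp ((hI.2 I).1 (InAdd.refl I)) Z).2 (Nat.lt_succ_self n))

end WTilt

theorem proposition4p8 (R : Type u) [CommRing R] [IsArtinianRing R] :
    (WTilt.WakamatsuTiltingConjecture R ↔ WTilt.ExactGorensteinSymmetry R) ∧
      (WTilt.WakamatsuTiltingConjecture R → WTilt.TiltingUpwardClosed R) := by
  exact ⟨⟨fun h => h.exactGorensteinSymmetry, fun h => h.wakamatsuTiltingConjecture⟩,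
    fun h => h.exactGorensteinSymmetry.tiltingUpwardClosed⟩
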